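/- Let $\tfrac14<h\le\tfrac12$, $2<p<4$ with $hp>1$. Let $(B_t)_{t\ge0}$ be a centred continuous $d$-dimensional Gaussian process with $B_0=0$, with independent components, and with $h$-long-time memory: there is a constant $C_h$ such that $\mathbb E|B_t-B_s|^2\le C_h|t-s|^{2h}$ for $s,t\ge0$, and $$\bigl|\mathbb E[(B^i_t-B^i_s)(B^i_{t+\tau}-B^i_{s+\tau})]\bigr|\le C_h\,\tau^{2h}\Bigl|\frac{t-s}{\tau}\Bigr|^2$$ for $1\le i\le d$, $s,t\ge0$, $\tau>0$ with $(t-s)/\tau\le1$. Let $W$ be the Banach space of continuous paths $w:[0,1]\to\mathbb R^d$ with $w_0=0$ (uniform norm), and let $\mathbb P$ be the law of $(B_t)_{0\le t\le1}$ on $W$. *Capacity.* The Cameron–Martin space $\mathcal H\subset W$ of $\mathbb P$ consists of the paths $\mathbb E[Zw]$, $Z$ in the closed subspace of $L^2(\mathbb P)$ generated by the continuous linear functionals on $W$, with $\langle\mathbb E[Z_1w],\mathbb E[Z_2w]\rangle_{\mathcal H}=\mathbb E[Z_1Z_2]$. For $q>1$ and $N\in\{0,1,2,\dots\}$, $\mathbb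 D^q_N$ is the completion of the space of smooth functionals (linear combinations of $f(\varphi_1,\dots,\varphi_n)$, $f$ Schwartz, $\varphi_j\in W^*$) under $\|F\|_{q,N}=\bigl(\sum_{i=0}^N\mathbb E\|D^iF\|^q_{\mathcal H^{\otimes i}}\bigr)^{1/q}$, where $D$ is the Malliavin derivative. For open $O\subset W$, $\mathrm{Cap}_{q,N}(O)=\inf\{\|u\|_{q,N}:u\in\mathbb D^q_N,\ u\ge1\text{ on }O\text{ and }u\ge0\text{ on }W,\ \mathbb P\text{-a.s.}\}$, and for $A\subset W$ arbitrary, $\mathrm{Cap}_{q,N}(A)=\inf\{\mathrm{Cap}_{q,N}(O):O\supset A\text{ open}\}$. *Rough paths.* For a continuous path $w$ of bounded variation, its lifting is $\mathbf w_{s,t}=(1,w^1_{s,t},\dots,w^{[p]}_{s,t})$, $0\le s\le t\le1$, where $w^k_{s,t}=\int_{s<t_1<\dots<t_k<t}dw_{t_1}\otimes\dots\otimes dw_{t_k}$. The space $G\Omega_p(\mathbb R^d)$ is the completion of the set of all such liftings (with $w_0=0$) under $$d_p(\mathbf u,\mathbf w)=\max_{1\le i\le[p]}\ \sup_{0=t_0<\dots<t_n=1}\Bigl(\sum_l|u^i_{t_{l-1},t_l}-w^i_{t_{l-1},t_l}|^{p/i}\Bigr)^{i/p},$$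 and $\delta_\varepsilon\mathbf w=(1,\varepsilon w^1,\dots,\varepsilon^{[p]}w^{[p]})$. For $m\ge1$ let $\Phi_m:(\mathbb R^d)^{2^m}\to G\Omega_p(\mathbb R^d)$ send $x=(x_1,\dots,x_{2^m})$ to the lifting of the path that is linear on each $[(k-1)/2^m,k/2^m]$, equals $x_k$ at $k/2^m$ for $1\le k\le 2^m$, and equals $0$ at $0$. For $w\in W$ let $\mathbf w^{(m)}=\Phi_m(w_{1/2^m},w_{2/2^m},\dots,w_1)$ and $T^{\varepsilon,m}(w)=\delta_\varepsilon\mathbf w^{(m)}$. *Rate function.* Let $\nu_m$ be the law of $(w_{1/2^m},w_{2/2^m},\dots,w_1)$ under $\mathbb P$, a Gaussian measure on $(\mathbb R^d)^{2^m}$, possibly degenerate. Put $J_m(x)=\tfrac12\|x\|^2_{\mathcal H(\nu_m)}$ if $x$ lies in the Cameron–Martin space $\mathcal H(\nu_m)$ of $\nu_m$ and $J_m(x)=\infty$ otherwise (so $J_m(x)=\tfrac12x^T\Sigma^{-1}x$ when the covariance matrix $\Sigma$ of $\nu_m$ is invertible), and $$I_m(\mathbf w)=\inf\{J_m(x):x\in(\mathbb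 R^d)^{2^m},\ \Phi_m(x)=\mathbf w\},\qquad \inf\emptyset=\infty .$$ **Claim.** For all $q>1$, $N\in\{0,1,2,\dots\}$ and $m\ge1$, the family $\{T^{\varepsilon,m}\}_{\varepsilon>0}$ satisfies the $\mathrm{Cap}_{q,N}$-large deviation principle on $G\Omega_p(\mathbb R^d)$ with good rate function $I_m$. That is, $I_m$ is lower semicontinuous, the level sets $\{I_m\le\alpha\}$, $0<\alpha<\infty$, are compact, for every closed $C\subset G\Omega_p(\mathbb R^d)$ $$\limsup_{\varepsilon\downarrow0}\varepsilon^2\log\mathrm{Cap}_{q,N}\{w\in W:T^{\varepsilon,m}(w)\in C\}\le-\frac1q\inf_{\mathbf w\in C}I_m(\mathbf w),$$ and for every open $G\subset G\Omega_p(\mathbb R^d)$ $$\liminf_{\varepsilon\downarrow0}\varepsilon^2\log\mathrm{Cap}_{q,N}\{w\in W:T^{\varepsilon,m}(w)\in G\}\ge-\frac1q\inf_{\mathbf w\in G}I_m(\mathbf w).$$ -/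

import Mathlib

open MeasureTheory ProbabilityTheory Filter Topology Set unitInterval
open scoped ENNReal NNReal SchwartzMap

noncomputable section

namespace RoughCap

/-! ### Path space and Gaussian processes with long-time memory -/

/-- `ℝᵈ` with its Euclidean norm. -/
abbrev Rd (d : ℕ) : Type := EuclideanSpace ℝ (Fin d)

/-- The continuous paths `w : [0,1] → ℝᵈ` with `w 0 = 0`, as a subspace of `C([0,1], ℝᵈ)`. -/
def basedPaths (d : ℕ) : Submodule ℝ C(I, Rd d) where
  carrier := {w | w 0 = 0}
  add_mem' {a b} ha hb := by
    have ha' : a 0 = 0 := ha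
    have hb' : b 0 = 0 := hb
    simp [ha', hb']
  zero_mem' := by simp
  smul_mem' c a ha := by
    have ha' : a 0 = 0 := ha
    simp [ha']

/-- The path space `W`, a Banach space under the supremum norm. -/
abbrev PathSpace (d : ℕ) : Type := ↥(basedPaths d)

instance (d : ℕ) : MeasurableSpace (PathSpace d) := borel _

instance (d : ℕ) : BorelSpace (PathSpace d) := ⟨rfl⟩

/-- A centred continuous `d`-dimensional Gaussian process `(B_t)_{t ≥ 0}` started at the origin,
with independent components and `h`-long-time memory. -/
structure HasLongTimeMemory {d : ℕ} {Ω : Type*} [MeasurableSpace Ω] (h : ℝ)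
    (B : ℝ≥0 → Ω → Rd d) (μ : Measure Ω) : Prop where
  measurable : ∀ t, Measurable (B t)
  gaussian : IsGaussianProcess B μ
  centred : ∀ t, ∫ ω, B t ω ∂μ = 0
  continuous : ∀ᵐ ω ∂μ, Continuous fun t => B t ω
  start : ∀ᵐ ω ∂μ, B 0 ω = 0
  indep : iIndepFun (fun (i : Fin d) (ω : Ω) (t : ℝ≥0) => B t ω i) μ
  memory : ∃ C : ℝ,
    (∀ s t : ℝ≥0, ∫ ω, ‖B t ω - B s ω‖ ^ 2 ∂μ ≤ C * |(t : ℝ) - s| ^ (2 * h)) ∧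
    ∀ (i : Fin d) (s t τ : ℝ≥0), 0 < τ → ((t : ℝ) - s) / τ ≤ 1 →
      |∫ ω, (B t ω i - B s ω i) * (B (t + τ) ω i - B (s + τ) ω i) ∂μ|
        ≤ C * (τ : ℝ) ^ (2 * h) * |((t : ℝ) - s) / τ| ^ 2

/-- `P` is the law on `W` of the process `B` restricted to the time interval `[0,1]`: both have the
same image on the product space `(ℝᵈ)^[0,1]`. -/
def IsPathLaw {d : ℕ} {Ω : Type*} [MeasurableSpace Ω] (P : Measure (PathSpace d))
    (B : ℝ≥0 → Ω → Rd d) (μ : Measure Ω) : Prop :=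
  P.map (fun (w : PathSpace d) (t : I) => (w : C(I, Rd d)) t)
    = μ.map (fun (ω : Ω) (t : I) => B ⟨(t : ℝ), t.2.1⟩ ω)

/-! ### Cameron–Martin space -/

section Wiener

variable {E : Type*} [NormedAddCommGroup E] [NormedSpace ℝ E] [MeasurableSpace E]

/-- The closed subspace of `L²(P)` generated by the continuous linear functionals. -/
def firstChaos (P : Measure E) : Set (Lp ℝ 2 P) :=
  closure {Z | ∃ φ : StrongDual ℝ E, Z =ᵐ[P] fun w => φ w}

/-- `h = 𝔼[Z w]` with `Z` in the closed `L²`-space generated by the linear functionals. The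
Cameron–Martin space `𝓗` consists of all such `h`, and `⟨h₁, h₂⟩_𝓗 = 𝔼[Z₁ Z₂]`. -/
def IsCameronMartin (P : Measure E) (Z : Lp ℝ 2 P) (h : E) : Prop :=
  Z ∈ firstChaos P ∧ ∀ φ : StrongDual ℝ E, φ h = ∫ w, Z w * φ w ∂P

/-- `½ ‖x‖_𝓗²` for `x` in the Cameron–Martin space `𝓗` of `P`, and `∞` for all other `x`
(the element `Z` representing a given `x` is unique when it exists). -/
def gaussianRate (P : Measure E) (x : E) : ℝ≥0∞ :=
  ⨅ (Z : Lp ℝ 2 P) (_ : IsCameronMartin P Z x), ENNReal.ofReal (‖Z‖ ^ 2 / 2)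

/-! ### Malliavin–Sobolev norms and capacities -/

/-- The Hilbert–Schmidt norm on `𝓗^{⊗ i}` of (the restriction to `𝓗` of) an `i`-linear form `T`:
the supremum over all finite orthonormal families `e` of `𝓗` of
`(∑_{a₁, …, aᵢ} T(e_{a₁}, …, e_{aᵢ})²)^{1/2}`. For `i = 0` it is the absolute value. -/
def hilbertNorm (P : Measure E) {i : ℕ} (T : E [×i]→L[ℝ] ℝ) : ℝ≥0∞ :=
  ⨆ (n : ℕ) (Z : Fin n → Lp ℝ 2 P) (e : Fin n → E) (_ : Orthonormal ℝ Z)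
    (_ : ∀ a, IsCameronMartin P (Z a) (e a)),
    (∑ a : Fin i → Fin n, ‖T fun l => e (a l)‖ₑ ^ 2) ^ (1 / 2 : ℝ)

/-- The space `𝓢` of smooth Wiener functionals: the linear span of the functionals
`F = f(φ₁, …, φₙ)` with `f` a Schwartz function and `φ₁, …, φₙ` continuous linear functionals. -/
def smoothFunctionals (E : Type*) [NormedAddCommGroup E] [NormedSpace ℝ E] :
    Submodule ℝ (E → ℝ) :=
  Submodule.span ℝ {F | ∃ (n : ℕ) (f : 𝓢(EuclideanSpace ℝ (Fin n), ℝ))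
    (φ : Fin n → StrongDual ℝ E), ∀ w, F w = f (WithLp.toLp 2 fun j => φ j w)}

/-- The norm `‖F‖_{q,N} = (∑_{i ≤ N} 𝔼 ‖Dⁱ F‖^q_{𝓗^{⊗ i}})^{1/q}` of a smooth functional. For
`F = f(φ₁, …, φₙ)` the Malliavin derivative
`Dⁱ F = ∑ (∂_{j₁} ⋯ ∂_{jᵢ} f)(φ₁, …, φₙ) ι^*φ_{j₁} ⊗ ⋯ ⊗ ι^*φ_{jᵢ}`, paired with
`h₁ ⊗ ⋯ ⊗ hᵢ`, is the iterated Fréchet derivative of `F` in the directions `h₁, …, hᵢ ∈ 𝓗`,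
because `⟨ι^*φ, h⟩_𝓗 = φ(h)`. -/
def sobolevNorm (P : Measure E) (q : ℝ) (N : ℕ) (F : E → ℝ) : ℝ≥0∞ :=
  (∑ i ∈ Finset.range (N + 1),
    ∫⁻ w, hilbertNorm P (iteratedFDeriv ℝ i F w) ^ q ∂P) ^ (1 / q)

/-- `u` is (the function underlying) an element of norm `c` of the Sobolev space `𝔻_N^q`, the
completion of `𝓢` under `‖·‖_{q,N}`: some `‖·‖_{q,N}`-Cauchy sequence in `𝓢` converges to `u` in
`L^q(P)`, and its norms converge to `c`. -/
def IsSobolev (P : Measure E) (q : ℝ) (N : ℕ) (u : E → ℝ) (c : ℝ≥0∞) : Prop :=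
  AEStronglyMeasurable u P ∧ ∃ F : ℕ → E → ℝ,
    (∀ k, F k ∈ smoothFunctionals E) ∧
    (∀ η : ℝ≥0∞, 0 < η → ∃ K : ℕ, ∀ k ≥ K, ∀ l ≥ K, sobolevNorm P q N (F k - F l) ≤ η) ∧
    Tendsto (fun k => eLpNorm (F k - u) (ENNReal.ofReal q) P) atTop (𝓝 0) ∧
    Tendsto (fun k => sobolevNorm P q N (F k)) atTop (𝓝 c)

/-- The `(q,N)`-capacity of an open set: the infimum of `‖u‖_{q,N}` over `u ∈ 𝔻_N^q` with `u ≥ 1`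
on `O` and `u ≥ 0`, almost surely. -/
def capOpen (P : Measure E) (q : ℝ) (N : ℕ) (O : Set E) : ℝ≥0∞ :=
  ⨅ (u : E → ℝ) (c : ℝ≥0∞) (_ : IsSobolev P q N u c)
    (_ : ∀ᵐ w ∂P, w ∈ O → 1 ≤ u w) (_ : ∀ᵐ w ∂P, 0 ≤ u w), c

/-- The `(q,N)`-capacity `Cap_{q,N}` of an arbitrary set. -/
def cap (P : Measure E) (q : ℝ) (N : ℕ) (A : Set E) : ℝ≥0∞ :=
  ⨅ (O : Set E) (_ : IsOpen O) (_ : A ⊆ O), capOpen P q N O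

/-- The family of maps `T ε`, `ε > 0`, satisfies the `Cap_{q,N}`-large deviation principle with
good rate function `J`. -/
structure CapLDP {X : Type*} [TopologicalSpace X] (P : Measure E) (q : ℝ) (N : ℕ)
    (T : ℝ → E → X) (J : X → ℝ≥0∞) : Prop where
  lowerSemicontinuous : LowerSemicontinuous J
  isCompact_level : ∀ α : ℝ≥0, 0 < α → IsCompact {y | J y ≤ α}
  upper : ∀ C : Set X, IsClosed C →
    limsup (fun ε : ℝ => ((ε ^ 2 : ℝ) : EReal) * ENNReal.log (cap P q N {w | T ε w ∈ C})) (𝓝[>] 0)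
      ≤ -(((1 / q : ℝ) : EReal) * ((⨅ x ∈ C, J x : ℝ≥0∞) : EReal))
  lower : ∀ G : Set X, IsOpen G →
    -(((1 / q : ℝ) : EReal) * ((⨅ x ∈ G, J x : ℝ≥0∞) : EReal))
      ≤ liminf (fun ε : ℝ => ((ε ^ 2 : ℝ) : EReal) * ENNReal.log (cap P q N {w | T ε w ∈ G}))
          (𝓝[>] 0)

end Wiener

/-! ### Iterated integrals and geometric rough paths -/

/-- A finite partition `s = t₀ < t₁ < ⋯ < tₙ = t` of `[s,t] ⊆ [0,1]`. -/
structure Partition (s t : I) where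
  n : ℕ
  pts : Fin (n + 1) → I
  strictMono : StrictMono pts
  first : pts 0 = s
  last : pts (Fin.last n) = t

/-- `J` is the Riemann–Stieltjes integral `∫_s^t f dg`: the limit of the Riemann–Stieltjes sums as
the mesh of the (tagged) partition tends to zero. -/
def HasRSIntegral (f g : I → ℝ) (s t : I) (J : ℝ) : Prop :=
  ∀ η : ℝ, 0 < η → ∃ δ : ℝ, 0 < δ ∧ ∀ (D : Partition s t) (ξ : Fin D.n → I),
    (∀ l : Fin D.n, (D.pts l.succ : ℝ) - D.pts l.castSucc < δ) →
    (∀ l : Fin D.n, D.pts l.castSucc ≤ ξ l ∧ ξ l ≤ D.pts l.succ) →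
    |∑ l : Fin D.n, f (ξ l) * (g (D.pts l.succ) - g (D.pts l.castSucc)) - J| < η

open Classical in
/-- The Riemann–Stieltjes integral `∫_s^t f dg` (and `0` if it does not exist). -/
def rsIntegral (f g : I → ℝ) (s t : I) : ℝ :=
  if h : ∃ J, HasRSIntegral f g s t J then h.choose else 0

/-- The coordinate `(j₁, …, j_k)` of the iterated integral
`∫_{s < t₁ < ⋯ < t_k < t} dw_{t₁} ⊗ ⋯ ⊗ dw_{t_k}`. -/
def iteratedIntegral {d : ℕ} (w : I → Rd d) : (k : ℕ) → (Fin k → Fin d) → I → I → ℝ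
  | 0, _, _, _ => 1
  | k + 1, j, s, t =>
      rsIntegral (fun u => iteratedIntegral w k (Fin.init j) s u) (fun u => w u (j (Fin.last k))) s t

/-- `(ℝᵈ)^{⊗ k}` in coordinates, with its Euclidean norm. -/
abbrev Tensor (d k : ℕ) : Type := EuclideanSpace ℝ (Fin k → Fin d)

/-- The simplex `Δ = {(s,t) : 0 ≤ s ≤ t ≤ 1}`. -/
abbrev Simplex : Type := {x : I × I // x.1 ≤ x.2}

/-- Functionals on `Δ` with values in `T^{(n)}(ℝᵈ) = ⨁_{k ≤ n} (ℝᵈ)^{⊗ k}`. -/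
abbrev Functional (d n : ℕ) : Type := Simplex → (k : Fin (n + 1)) → Tensor d k

/-- The lifting `(1, w¹, …, wⁿ)` of a path `w` up to degree `n`. -/
def pathLift {d : ℕ} (n : ℕ) (w : I → Rd d) : Functional d n :=
  fun x k => WithLp.toLp 2 fun j => iteratedIntegral w k j x.1.1 x.1.2

/-- The dilation `δ_ε (1, w¹, …, wⁿ) = (1, ε w¹, …, εⁿ wⁿ)`. -/
def dilate {d n : ℕ} (ε : ℝ) (x : Functional d n) : Functional d n :=
  fun st k => ε ^ (k : ℕ) • x st k

/-- The space `Ω_{[p]}^∞(ℝᵈ)` of liftings, up to degree `[p]`, of continuous paths of bounded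
variation started at the origin. -/
def SmoothRoughPath (d : ℕ) (p : ℝ) : Type :=
  {x : Functional d ⌊p⌋₊ // ∃ w : PathSpace d,
    BoundedVariationOn (w : C(I, Rd d)) univ ∧ x = pathLift ⌊p⌋₊ (w : C(I, Rd d))}

/-- The pair of consecutive points `(t_{l-1}, t_l)` of a partition. -/
def Partition.interval {s t : I} (D : Partition s t) (l : Fin D.n) : Simplex :=
  ⟨(D.pts l.castSucc, D.pts l.succ), D.strictMono.monotone l.castSucc_lt_succ.le⟩

/-- The `p`-variation metric
`d_p(x,y) = max_{1 ≤ i ≤ [p]} sup_D (∑_l |x^i_{t_{l-1},t_l} - y^i_{t_{l-1},t_l}|^{p/i})^{i/p}`. -/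
def pVarDist {d n : ℕ} (p : ℝ) (x y : Functional d n) : ℝ≥0∞ :=
  ⨆ (i : Fin (n + 1)) (_ : 1 ≤ (i : ℕ)) (D : Partition 0 1),
    (∑ l : Fin D.n, edist (x (D.interval l) i) (y (D.interval l) i) ^ (p / (i : ℕ)))
      ^ (((i : ℕ) : ℝ) / p)

theorem pVarDist_triangle {d : ℕ} (p : ℝ) (x y z : Functional d ⌊p⌋₊) :
    pVarDist p x z ≤ pVarDist p x y + pVarDist p y z := by
  refine iSup_le fun i => iSup_le fun hi => iSup_le fun D => ?_
  have hip : ((i : ℕ) : ℝ) ≤ p := (Nat.le_floor_iff' (by omega)).1 (by omega)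
  have hi0 : (0 : ℝ) < ((i : ℕ) : ℝ) := by exact_mod_cast hi
  have h1 : 1 ≤ p / (i : ℕ) := by rwa [le_div_iff₀ hi0, one_mul]
  have key : ∀ a b : Functional d ⌊p⌋₊,
      (∑ l : Fin D.n, edist (a (D.interval l) i) (b (D.interval l) i) ^ (p / (i : ℕ)))
        ^ (((i : ℕ) : ℝ) / p) ≤ pVarDist p a b := fun a b =>
    le_iSup_of_le i (le_iSup_of_le hi (le_iSup_of_le D le_rfl))
  refine le_trans ?_ (add_le_add (key x y) (key y z))
  have := ENNReal.Lp_add_le Finset.univ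
    (fun l : Fin D.n => edist (x (D.interval l) i) (y (D.interval l) i))
    (fun l : Fin D.n => edist (y (D.interval l) i) (z (D.interval l) i)) h1
  rw [one_div_div] at this
  refine le_trans ?_ this
  have hp : 0 < p := lt_of_lt_of_le hi0 hip
  gcongr
  exact edist_triangle _ _ _

theorem pVarDist_self {d : ℕ} (p : ℝ) (x : Functional d ⌊p⌋₊) : pVarDist p x x = 0 := by
  refine le_antisymm (iSup_le fun i => iSup_le fun hi => iSup_le fun D => ?_) zero_le
  have hip : ((i : ℕ) : ℝ) ≤ p := (Nat.le_floor_iff' (by omega)).1 (by omega)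
  have hi0 : (0 : ℝ) < ((i : ℕ) : ℝ) := by exact_mod_cast hi
  have hp : 0 < p := lt_of_lt_of_le hi0 hip
  simp [ENNReal.zero_rpow_of_pos (div_pos hp hi0), ENNReal.zero_rpow_of_pos (div_pos hi0 hp)]

theorem pVarDist_comm {d n : ℕ} (p : ℝ) (x y : Functional d n) :
    pVarDist p x y = pVarDist p y x := by
  simp only [pVarDist, edist_comm]

instance (d : ℕ) (p : ℝ) : PseudoEMetricSpace (SmoothRoughPath d p) where
  edist x y := pVarDist p x.1 y.1
  edist_self x := pVarDist_self p x.1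
  edist_comm x y := pVarDist_comm p x.1 y.1
  edist_triangle x y z := pVarDist_triangle p x.1 y.1 z.1

/-- The space `GΩ_p(ℝᵈ)` of geometric `p`-rough paths: the completion of `Ω_{[p]}^∞(ℝᵈ)` under the
`p`-variation metric. -/
abbrev GeometricRoughPath (d : ℕ) (p : ℝ) : Type := UniformSpace.Completion (SmoothRoughPath d p)

/-! #### The dilation of a lifting is the lifting of the multiplied path -/

theorem exists_partition {s t : I} (hst : s ≤ t) {δ : ℝ} (hδ : 0 < δ) :
    ∃ D : Partition s t, ∀ l : Fin D.n, (D.pts l.succ : ℝ) - D.pts l.castSucc < δ := by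
  rcases hst.eq_or_lt with rfl | hlt
  · exact ⟨⟨0, fun _ => s, Subsingleton.strictMono (α := Fin 1) _, rfl, rfl⟩, fun l => l.elim0⟩
  · have hlt' : (s : ℝ) < t := hlt
    obtain ⟨n, hn⟩ := exists_nat_gt (((t : ℝ) - s) / δ)
    have hn0 : (0 : ℝ) < n := lt_of_le_of_lt (div_nonneg (by linarith) hδ.le) hn
    have hmem : ∀ j : Fin (n + 1), (s : ℝ) + (t - s) * ((j : ℕ) / n) ∈ I := by
      intro j
      have hj : ((j : ℕ) : ℝ) ≤ n := by exact_mod_cast Nat.lt_succ_iff.1 j.2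
      have h0 : (0 : ℝ) ≤ ((j : ℕ) : ℝ) / n := by positivity
      have h1 : ((j : ℕ) : ℝ) / n ≤ 1 := (div_le_one hn0).2 hj
      have hs := s.2.1
      have ht := t.2.2
      exact ⟨by nlinarith, by nlinarith⟩
    refine ⟨⟨n, fun j => ⟨_, hmem j⟩, ?_, ?_, ?_⟩, ?_⟩
    · intro a b hab
      have hab' : ((a : ℕ) : ℝ) < (b : ℕ) := by exact_mod_cast hab
      have : ((a : ℕ) : ℝ) / n < ((b : ℕ) : ℝ) / n := div_lt_div_of_pos_right hab' hn0
      refine Subtype.mk_lt_mk.2 ?_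
      nlinarith
    · apply Subtype.ext
      simp
    · apply Subtype.ext
      simp [div_self hn0.ne']
    · intro l
      simp only [Fin.val_succ, Fin.val_castSucc]
      have : ((t : ℝ) - s) / n < δ := by
        rw [div_lt_iff₀ hδ] at hn
        rw [div_lt_iff₀ hn0]
        linarith
      push_cast
      have e : (s : ℝ) + (t - s) * (((l : ℕ) + 1) / n) - (s + (t - s) * ((l : ℕ) / n))
          = (t - s) / n := by
        field_simp
        ring
      linarith

theorem HasRSIntegral.unique {f g : I → ℝ} {s t : I} (hst : s ≤ t) {J K : ℝ}
    (hJ : HasRSIntegral f g s t J) (hK : HasRSIntegral f g s t K) : J = K := by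
  by_contra hne
  have hpos : 0 < |J - K| / 2 := by
    have := abs_pos.2 (sub_ne_zero.2 hne)
    positivity
  obtain ⟨δ₁, h₁, H₁⟩ := hJ _ hpos
  obtain ⟨δ₂, h₂, H₂⟩ := hK _ hpos
  obtain ⟨D, hD⟩ := exists_partition hst (lt_min h₁ h₂)
  have htag : ∀ l : Fin D.n, D.pts l.castSucc ≤ D.pts l.castSucc ∧ D.pts l.castSucc ≤ D.pts l.succ :=
    fun l => ⟨le_rfl, D.strictMono.monotone l.castSucc_lt_succ.le⟩
  have a := H₁ D (fun l => D.pts l.castSucc) (fun l => (hD l).trans_le (min_le_left _ _)) htag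
  have b := H₂ D (fun l => D.pts l.castSucc) (fun l => (hD l).trans_le (min_le_right _ _)) htag
  rw [abs_sub_comm] at a
  have := abs_sub_le J (∑ l : Fin D.n, f (D.pts l.castSucc)
    * (g (D.pts l.succ) - g (D.pts l.castSucc))) K
  linarith

theorem Partition.first_le {s t : I} (D : Partition s t) (j : Fin (D.n + 1)) : s ≤ D.pts j := by
  simpa only [D.first] using D.strictMono.monotone (Fin.zero_le j)

theorem HasRSIntegral.smul {f g f' g' : I → ℝ} {s t : I} {a b J : ℝ}
    (hf : ∀ u, s ≤ u → f' u = a * f u) (hg : ∀ u, g' u = b * g u)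
    (h : HasRSIntegral f g s t J) : HasRSIntegral f' g' s t (a * b * J) := by
  intro η hη
  obtain ⟨δ, hδ, H⟩ := h (η / (|a * b| + 1)) (by positivity)
  refine ⟨δ, hδ, fun D ξ hm hξ => ?_⟩
  have hs : ∑ l : Fin D.n, f' (ξ l) * (g' (D.pts l.succ) - g' (D.pts l.castSucc))
      = a * b * ∑ l : Fin D.n, f (ξ l) * (g (D.pts l.succ) - g (D.pts l.castSucc)) := by
    rw [Finset.mul_sum]
    refine Finset.sum_congr rfl fun l _ => ?_
    rw [hf _ ((D.first_le _).trans (hξ l).1), hg, hg]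
    ring
  rw [hs, ← mul_sub, abs_mul]
  have h1 := H D ξ hm hξ
  rw [lt_div_iff₀ (by positivity)] at h1
  have h2 := abs_nonneg (∑ l : Fin D.n, f (ξ l) * (g (D.pts l.succ) - g (D.pts l.castSucc)) - J)
  nlinarith

theorem rsIntegral_eq {f g : I → ℝ} {s t : I} (hst : s ≤ t) {J : ℝ}
    (h : HasRSIntegral f g s t J) : rsIntegral f g s t = J := by
  have hex : ∃ J, HasRSIntegral f g s t J := ⟨J, h⟩
  rw [rsIntegral, dif_pos hex]
  exact hex.choose_spec.unique hst h

theorem rsIntegral_smul {f g f' g' : I → ℝ} {s t : I} (hst : s ≤ t) {a b : ℝ}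
    (hf : ∀ u, s ≤ u → f' u = a * f u) (hg : ∀ u, g' u = b * g u) :
    rsIntegral f' g' s t = a * b * rsIntegral f g s t := by
  by_cases hex : ∃ J, HasRSIntegral f g s t J
  · obtain ⟨J, hJ⟩ := hex
    rw [rsIntegral_eq hst hJ, rsIntegral_eq hst (hJ.smul hf hg)]
  · rw [show rsIntegral f g s t = 0 from dif_neg hex, mul_zero]
    by_cases hab : a * b = 0
    · refine rsIntegral_eq hst fun η hη => ⟨1, one_pos, fun D ξ _ hξ => ?_⟩
      rw [Finset.sum_eq_zero, sub_zero, abs_zero]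
      · exact hη
      · intro l _
        rw [hf _ ((D.first_le _).trans (hξ l).1), hg, hg,
          show a * f (ξ l) * (b * g (D.pts l.succ) - b * g (D.pts l.castSucc))
            = a * b * (f (ξ l) * (g (D.pts l.succ) - g (D.pts l.castSucc))) by ring, hab, zero_mul]
    · have ha : a ≠ 0 := left_ne_zero_of_mul hab
      have hb : b ≠ 0 := right_ne_zero_of_mul hab
      refine dif_neg fun ⟨J, hJ⟩ => hex ⟨a⁻¹ * b⁻¹ * J, hJ.smul (fun u hu => ?_) fun u => ?_⟩
      · rw [hf u hu, inv_mul_cancel_left₀ ha]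
      · rw [hg u, inv_mul_cancel_left₀ hb]

theorem iteratedIntegral_smul {d : ℕ} (ε : ℝ) (w w' : I → Rd d) (hw : ∀ u, w' u = ε • w u)
    (k : ℕ) : ∀ (j : Fin k → Fin d) (s t : I), s ≤ t →
      iteratedIntegral w' k j s t = ε ^ k * iteratedIntegral w k j s t := by
  induction k with
  | zero => intro j s t _; simp [iteratedIntegral]
  | succ k ih =>
    intro j s t hst
    rw [pow_succ]
    exact rsIntegral_smul hst (fun u hu => ih _ s u hu) fun u => by simp [hw u]

theorem dilate_lift {d : ℕ} (n : ℕ) (ε : ℝ) (w w' : I → Rd d) (hw : ∀ u, w' u = ε • w u) :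
    dilate ε (pathLift n w) = pathLift n w' := by
  funext x k
  ext j
  simp [dilate, pathLift, iteratedIntegral_smul ε w w' hw k j _ _ x.2]

/-- The dilation `δ_ε` on `Ω_{[p]}^∞(ℝᵈ)`. -/
def SmoothRoughPath.dilate {d : ℕ} {p : ℝ} (ε : ℝ) (x : SmoothRoughPath d p) :
    SmoothRoughPath d p :=
  ⟨RoughCap.dilate ε x.1, by
    obtain ⟨w, hw, hx⟩ := x.2
    refine ⟨ε • w, ?_, ?_⟩
    · exact (lipschitzWith_smul ε).comp_boundedVariationOn hw
    · rw [hx]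
      exact dilate_lift _ ε _ _ fun u => rfl⟩

/-! ### Dyadic piecewise linear interpolation -/

/-- The values at the dyadic points `k / 2^m`, `0 ≤ k ≤ 2^m`, prescribed by a vector
`x = (x₁, …, x_{2^m})`, with the value `0` at time `0`. -/
def node {d m : ℕ} (x : Fin (2 ^ m) → Rd d) : ℕ → Rd d
  | 0 => 0
  | k + 1 => if h : k < 2 ^ m then x ⟨k, h⟩ else 0

/-- The function `0` before time `k / 2^m`, `1` after time `(k+1) / 2^m`, and linear in between. -/
def ramp (m k : ℕ) (t : ℝ) : ℝ := max 0 (min 1 (2 ^ m * t - k))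

theorem continuous_ramp (m k : ℕ) : Continuous (ramp m k) := by
  unfold ramp
  fun_prop

/-- The piecewise linear path with values `x₁, …, x_{2^m}` at the times `k / 2^m`
(see `dyadicPath_apply` for the usual formula on each dyadic interval). -/
def dyadicPath {d : ℕ} (m : ℕ) (x : Fin (2 ^ m) → Rd d) : PathSpace d :=
  ⟨⟨fun t => ∑ k ∈ Finset.range (2 ^ m), ramp m k (t : ℝ) • (node x (k + 1) - node x k),
    continuous_finsetSum _ fun k _ =>
      ((continuous_ramp m k).comp continuous_subtype_val).smul continuous_const⟩, by
    show ∑ k ∈ Finset.range (2 ^ m), ramp m k ((0 : I) : ℝ) • (node x (k + 1) - node x k) = 0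
    refine Finset.sum_eq_zero fun k _ => ?_
    have : ramp m k ((0 : I) : ℝ) = 0 := by simp [ramp]
    rw [this, zero_smul]⟩

/-- On `[k / 2^m, (k+1) / 2^m]` the path is `x_k + 2^m (t - k / 2^m) (x_{k+1} - x_k)`. -/
theorem dyadicPath_apply {d m : ℕ} (x : Fin (2 ^ m) → Rd d) {k : ℕ} (hk : k < 2 ^ m) (t : I)
    (h₁ : (k : ℝ) / 2 ^ m ≤ t) (h₂ : (t : ℝ) ≤ (k + 1) / 2 ^ m) :
    (dyadicPath m x : C(I, Rd d)) t
      = node x k + ((2 : ℝ) ^ m * (t - k / 2 ^ m)) • (node x (k + 1) - node x k) := by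
  have h2 : (0 : ℝ) < 2 ^ m := by positivity
  rw [div_le_iff₀ h2] at h₁
  rw [le_div_iff₀ h2] at h₂
  show ∑ j ∈ Finset.range (2 ^ m), ramp m j (t : ℝ) • (node x (j + 1) - node x j) = _
  have hlow : ∀ j ∈ Finset.range k, ramp m j (t : ℝ) • (node x (j + 1) - node x j)
      = node x (j + 1) - node x j := by
    intro j hj
    have hj' : (j : ℝ) + 1 ≤ k := by exact_mod_cast Finset.mem_range.1 hj
    have : ramp m j (t : ℝ) = 1 := by
      rw [ramp, min_eq_left (by linarith), max_eq_right zero_le_one]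
    rw [this, one_smul]
  have hhigh : ∀ j ∈ Finset.range (2 ^ m), j ∉ Finset.range (k + 1) →
      ramp m j (t : ℝ) • (node x (j + 1) - node x j) = 0 := by
    intro j _ hj
    have hj' : (k : ℝ) + 1 ≤ j := by
      have : k + 1 ≤ j := by simpa using hj
      exact_mod_cast this
    have : ramp m j (t : ℝ) = 0 := by
      rw [ramp, max_eq_left]
      exact (min_le_right _ _).trans (by linarith)
    rw [this, zero_smul]
  rw [← Finset.sum_subset (Finset.range_subset_range.2 (Nat.succ_le_of_lt hk)) hhigh,
    Finset.sum_range_succ, Finset.sum_congr rfl hlow, Finset.sum_range_sub]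
  have : ramp m k (t : ℝ) = 2 ^ m * (t - k / 2 ^ m) := by
    rw [ramp, min_eq_right (by linarith), max_eq_right (by linarith)]
    field_simp
  rw [this]
  simp [node]

theorem lipschitzWith_ramp (m k : ℕ) : LipschitzWith (2 ^ m) (ramp m k) := by
  have h : LipschitzWith (2 ^ m) fun t : ℝ => 2 ^ m * t - k := by
    refine LipschitzWith.of_dist_le_mul fun a b => le_of_eq ?_
    rw [Real.dist_eq, Real.dist_eq, show (2 : ℝ) ^ m * a - k - (2 ^ m * b - k) = 2 ^ m * (a - b) by
      ring, abs_mul, abs_of_pos (by positivity)]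
    push_cast
    rfl
  exact (h.const_min 1).const_max 0

theorem boundedVariationOn_dyadicPath {d m : ℕ} (x : Fin (2 ^ m) → Rd d) :
    BoundedVariationOn (dyadicPath m x : C(I, Rd d)) univ := by
  have key : ∀ n : ℕ, ∃ C : ℝ≥0, LipschitzWith C fun t : ℝ =>
      ∑ k ∈ Finset.range n, ramp m k t • (node x (k + 1) - node x k) := by
    intro n
    induction n with
    | zero => exact ⟨0, by simp [LipschitzWith]⟩
    | succ n ih =>
      obtain ⟨C, hC⟩ := ih
      have h := (ContinuousLinearMap.toSpanSingleton ℝ (node x (n + 1) - node x n)).lipschitz.comp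
        (lipschitzWith_ramp m n)
      simp only [Finset.sum_range_succ]
      exact ⟨_, hC.add h⟩
  obtain ⟨C, hC⟩ := key (2 ^ m)
  have hv : BoundedVariationOn (fun t : I => (t : ℝ)) univ :=
    MonotoneOn.boundedVariationOn (C := 1) (fun a _ b _ hab => hab) fun t _ => by
      rw [abs_of_nonneg t.2.1]
      exact t.2.2
  exact hC.comp_boundedVariationOn hv

/-- The sampling map `π_m w = (w_{1/2^m}, w_{2/2^m}, …, w_1)`. -/
def sample {d : ℕ} (m : ℕ) (w : PathSpace d) : Fin (2 ^ m) → Rd d :=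
  fun k => (w : C(I, Rd d)) ⟨((k : ℕ) + 1) / 2 ^ m, by positivity, by
    rw [div_le_one (by positivity)]
    exact_mod_cast k.2⟩

/-- The lifting, in `Ω_{[p]}^∞(ℝᵈ)`, of the dyadic piecewise linear path through `x`. -/
def dyadicLift {d : ℕ} (p : ℝ) (m : ℕ) (x : Fin (2 ^ m) → Rd d) : SmoothRoughPath d p :=
  ⟨pathLift ⌊p⌋₊ (dyadicPath m x : C(I, Rd d)), dyadicPath m x, boundedVariationOn_dyadicPath x, rfl⟩

/-- The map `Φ_m : (ℝᵈ)^{2^m} → GΩ_p(ℝᵈ)`. -/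
def Phi {d : ℕ} (p : ℝ) (m : ℕ) (x : Fin (2 ^ m) → Rd d) : GeometricRoughPath d p :=
  (dyadicLift p m x : SmoothRoughPath d p)

/-- The map `T^{ε,m} : W → GΩ_p(ℝᵈ)`, `w ↦ δ_ε 𝐰^{(m)}`, where `𝐰^{(m)}` is the lifting of the
dyadic piecewise linear interpolation `w^{(m)}` of `w`. -/
def dilatedLift {d : ℕ} (p : ℝ) (m : ℕ) (ε : ℝ) (w : PathSpace d) : GeometricRoughPath d p :=
  ((dyadicLift p m (sample m w)).dilate ε : SmoothRoughPath d p)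

/-- The rate function `J_m` of the Gaussian law `ν_m` of the dyadic sample vector. -/
def sampleRate {d : ℕ} (P : Measure (PathSpace d)) (m : ℕ) (x : Fin (2 ^ m) → Rd d) : ℝ≥0∞ :=
  gaussianRate (P.map (sample m)) x

/-- The rate function `I_m(𝐰) = inf {J_m(x) : Φ_m(x) = 𝐰}`. -/
def liftRate {d : ℕ} (P : Measure (PathSpace d)) (p : ℝ) (m : ℕ) (y : GeometricRoughPath d p) :
    ℝ≥0∞ :=
  ⨅ (x : Fin (2 ^ m) → Rd d) (_ : Phi p m x = y), sampleRate P m x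

end RoughCap

end

open RoughCap

namespace RoughCap

/-! ### Malliavin–Sobolev norms of functions of linear functionals -/

section Malliavin

/-! Lifting commutes with scaling, so T^{ε,m}(w) = Φ_m(ε L w) with L the linear sampling map into a
finite-dimensional space (`dilatedLift_eq`), and Φ_m is continuous (`continuous_Phi`). The claim is
thus a contraction principle for capacities: it suffices to treat a continuous image of ε L w, where
L has a centred, possibly degenerate, Gaussian law ν under P (`capLDP_of_isGaussian_map`).

Both bounds compare capacity with P^{1/q}, which is the source of the factor 1/q. The lower
comparison Cap ≥ P^{1/q} always holds, since the Sobolev norm dominates the L^q norm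
(`measure_rpow_le_cap`). It is combined with a Gaussian lower bound near a Cameron–Martin point x
represented by φ (`exists_measure_smul_mem_ge`), where y splits into a multiple of φ(y) in the
direction x and a remainder independent of φ.

For the upper bound, duality gives J(x) ≤ β iff φ(x)² ≤ 2β Var φ for every functional φ. A closed
set on which J > a is therefore covered by finitely many half-spaces {ψ > c + 1} with c² ≥ 2a Var ψ;
compactness handles a box and coordinate half-spaces its complement (`exists_finset_halfSpaces`).
The sum of the cutoffs θ(εψ − c) is at least 1 on the event, vanishes unless some εψ exceeds c, and
for ε < 1 has derivatives bounded independently of ε. Hence the capacity is at most K P(some εψ ≥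
c)^{1/q} (`exists_cap_halfSpaces_le`), and Chernoff bounds this probability by a multiple of
e^{-a/ε²}. The margin 1 hosts the transition of θ and costs nothing at the exponential scale.

Continuity of Φ_m follows from the Lipschitz dependence of iterated Riemann–Stieltjes integrals on
Lipschitz paths. -/

theorem iteratedFDeriv_comp_dual {E : Type*} [NormedAddCommGroup E] [NormedSpace ℝ E]
    {g : ℝ → ℝ} {i : ℕ} (hg : ContDiff ℝ i g) (ψ : StrongDual ℝ E)
    (w : E) (e : Fin i → E) :
    iteratedFDeriv ℝ i (fun w => g (ψ w)) w e = iteratedDeriv i g (ψ w) * ∏ l, ψ (e l) := by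
  have := ψ.iteratedFDeriv_comp_right hg w (i := i) le_rfl
  rw [show (fun w => g (ψ w)) = g ∘ ψ from rfl, this,
    ContinuousMultilinearMap.compContinuousLinearMap_apply,
    iteratedFDeriv_apply_eq_iteratedDeriv_mul_prod, smul_eq_mul, mul_comm]

variable {E : Type*} [NormedAddCommGroup E] [NormedSpace ℝ E] [MeasurableSpace E]

/-- The empty orthonormal family suffices: at order 0 the sum has exactly one term, whatever the
family. -/
theorem enorm_le_hilbertNorm_zero (P : Measure E) (F : E → ℝ) (w : E) :
    ‖F w‖ₑ ≤ hilbertNorm P (iteratedFDeriv ℝ 0 F w) := by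
  refine le_iSup_of_le 0 (le_iSup_of_le Fin.elim0 (le_iSup_of_le Fin.elim0
    (le_iSup_of_le ?_ (le_iSup_of_le (fun a => a.elim0) ?_))))
  · exact ⟨fun a => a.elim0, fun a => a.elim0⟩
  · simp only [iteratedFDeriv_zero_apply, Finset.univ_unique, Finset.sum_const,
      Finset.card_singleton, one_smul]
    rw [← ENNReal.rpow_natCast, ← ENNReal.rpow_mul]
    simp

theorem hilbertNorm_zero (P : Measure E) {i : ℕ} : hilbertNorm P (0 : E [×i]→L[ℝ] ℝ) = 0 := by
  simp [hilbertNorm]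

theorem hilbertNorm_add_le (P : Measure E) {i : ℕ} (T T' : E [×i]→L[ℝ] ℝ) :
    hilbertNorm P (T + T') ≤ hilbertNorm P T + hilbertNorm P T' := by
  refine iSup_le fun n => iSup_le fun Z => iSup_le fun e => iSup_le fun hZ => iSup_le fun he => ?_
  have key : ∀ S : E [×i]→L[ℝ] ℝ,
      (∑ a : Fin i → Fin n, ‖S fun l => e (a l)‖ₑ ^ 2) ^ (1 / 2 : ℝ) ≤ hilbertNorm P S := fun S =>
    le_iSup_of_le n (le_iSup_of_le Z (le_iSup_of_le e (le_iSup_of_le hZ (le_iSup_of_le he le_rfl))))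
  refine le_trans ?_ (add_le_add (key T) (key T'))
  have := ENNReal.Lp_add_le Finset.univ (fun a : Fin i → Fin n => ‖T fun l => e (a l)‖ₑ)
    (fun a => ‖T' fun l => e (a l)‖ₑ) (p := 2) one_le_two
  simp only [ENNReal.rpow_ofNat] at this
  refine le_trans ?_ this
  gcongr with a
  exact enorm_add_le _ _

theorem hilbertNorm_sum_le (P : Measure E) {i : ℕ} {ι : Type*} (s : Finset ι)
    (T : ι → E [×i]→L[ℝ] ℝ) : hilbertNorm P (∑ j ∈ s, T j) ≤ ∑ j ∈ s, hilbertNorm P (T j) :=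
  Finset.le_sum_of_subadditive _ (hilbertNorm_zero P).le (hilbertNorm_add_le P) s T

/-- Bessel's inequality in L²(P): the Cameron–Martin relation makes ψ(e_a) the inner product of Z_a
with ψ. -/
theorem sum_enorm_sq_le_of_orthonormal {P : Measure E} {n : ℕ} {Z : Fin n → Lp ℝ 2 P}
    {e : Fin n → E} (hZ : Orthonormal ℝ Z) (he : ∀ a, IsCameronMartin P (Z a) (e a))
    (ψ : StrongDual ℝ E) (hψ : MemLp ψ 2 P) :
    ∑ a, ‖ψ (e a)‖ₑ ^ 2 ≤ eLpNorm ψ 2 P ^ 2 := by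
  have hin : ∀ a, inner ℝ (Z a) (hψ.toLp ψ) = ψ (e a) := by
    intro a
    rw [L2.inner_def, (he a).2 ψ]
    refine integral_congr_ae ?_
    filter_upwards [hψ.coeFn_toLp] with w hw
    rw [hw]
    simp [mul_comm]
  have hb := hZ.sum_inner_products_le (hψ.toLp ψ) (s := Finset.univ)
  simp only [hin] at hb
  rw [Lp.norm_toLp] at hb
  have h1 : ∑ a, ‖ψ (e a)‖ₑ ^ 2 = ENNReal.ofReal (∑ a, ‖ψ (e a)‖ ^ 2) := by
    rw [ENNReal.ofReal_sum_of_nonneg fun _ _ => by positivity]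
    refine Finset.sum_congr rfl fun a _ => ?_
    rw [ENNReal.ofReal_pow (norm_nonneg _), ofReal_norm]
  rw [h1]
  refine (ENNReal.ofReal_le_ofReal hb).trans ?_
  rw [ENNReal.ofReal_pow ENNReal.toReal_nonneg, ENNReal.ofReal_toReal hψ.eLpNorm_ne_top]

/-- For c ψ^{⊗i} the sum over multi-indices factors as c² (∑ ψ(e_b)²)^i, and Bessel bounds each
factor. -/
theorem hilbertNorm_le_of_forall_eq {P : Measure E} {i : ℕ} {T : E [×i]→L[ℝ] ℝ} {c : ℝ}
    {ψ : StrongDual ℝ E} (hψ : MemLp ψ 2 P) (hT : ∀ e, T e = c * ∏ l, ψ (e l)) :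
    hilbertNorm P T ≤ ‖c‖ₑ * eLpNorm ψ 2 P ^ i := by
  refine iSup_le fun n => iSup_le fun Z => iSup_le fun e => iSup_le fun hZ => iSup_le fun he => ?_
  have h1 : ∑ a : Fin i → Fin n, ‖T fun l => e (a l)‖ₑ ^ 2
      = ‖c‖ₑ ^ 2 * (∑ b, ‖ψ (e b)‖ₑ ^ 2) ^ i := by
    rw [Fintype.sum_pow, Finset.mul_sum]
    refine Finset.sum_congr rfl fun a _ => ?_
    rw [hT, enorm_mul, mul_pow, Finset.prod_pow]
    congr 2
    simp only [enorm_eq_nnnorm, nnnorm_prod, ENNReal.ofNNReal_finsetProd]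
  have h2 : ∑ a : Fin i → Fin n, ‖T fun l => e (a l)‖ₑ ^ 2
      ≤ (‖c‖ₑ * eLpNorm ψ 2 P ^ i) ^ 2 := by
    rw [h1, mul_pow, ← pow_mul, mul_comm i 2, pow_mul]
    gcongr
    exact sum_enorm_sq_le_of_orthonormal hZ he ψ hψ
  refine (ENNReal.rpow_le_rpow h2 (by norm_num)).trans_eq ?_
  rw [← ENNReal.rpow_natCast, ← ENNReal.rpow_mul]
  simp

/-- A sum of functions of finitely many linear functionals, whose derivatives are bounded and
vanish where the functionals are small, has a Sobolev norm controlled by the probability that one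
of the functionals is large. -/
theorem sobolevNorm_sum_comp_dual_le [OpensMeasurableSpace E] {P : Measure E} {q : ℝ} (hq : 1 < q)
    {N : ℕ} {ι : Type*} [Fintype ι] {g : ι → ℝ → ℝ} {ψ : ι → StrongDual ℝ E} {κ : ι → ℝ}
    {C R : ℝ≥0} (hR : 1 ≤ R) (hg : ∀ j, ContDiff ℝ N (g j)) (hψ : ∀ j, MemLp (ψ j) 2 P)
    (hψR : ∀ j, eLpNorm (ψ j) 2 P ≤ R)
    (hC : ∀ j, ∀ i ≤ N, ∀ y, ‖iteratedDeriv i (g j) y‖ₑ ≤ C)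
    (h0 : ∀ j, ∀ i ≤ N, ∀ y < κ j, iteratedDeriv i (g j) y = 0) :
    sobolevNorm P q N (fun w => ∑ j, g j (ψ j w)) ≤
      (((N : ℝ≥0∞) + 1) * (Fintype.card ι * C * R ^ N) ^ q) ^ (1 / q)
        * P {w | ∃ j, κ j ≤ ψ j w} ^ (1 / q) := by
  set K : ℝ≥0∞ := Fintype.card ι * C * R ^ N with hK
  set U : Set E := {w | ∃ j, κ j ≤ ψ j w} with hU
  have hq0 : 0 < q := by linarith
  have hUm : MeasurableSet U := by
    have : U = ⋃ j, {w | κ j ≤ ψ j w} := by ext; simp [hU]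
    rw [this]
    exact MeasurableSet.iUnion fun j => (isClosed_le continuous_const (ψ j).continuous).measurableSet
  have hpt : ∀ i ≤ N, ∀ w, hilbertNorm P (iteratedFDeriv ℝ i (fun w => ∑ j, g j (ψ j w)) w)
      ≤ U.indicator (fun _ => K) w := by
    intro i hi w
    have hgi : ∀ j, ContDiff ℝ i (g j) := fun j => (hg j).of_le (by exact_mod_cast hi)
    have e1 : iteratedFDeriv ℝ i (fun w => ∑ j, g j (ψ j w)) w
        = ∑ j, iteratedFDeriv ℝ i (fun w => g j (ψ j w)) w := by
      exact iteratedFDeriv_fun_sum_apply fun j _ => ((hgi j).comp (ψ j).contDiff).contDiffAt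
    rw [e1]
    refine (hilbertNorm_sum_le P _ _).trans ?_
    have hj : ∀ j, hilbertNorm P (iteratedFDeriv ℝ i (fun w => g j (ψ j w)) w)
        ≤ ‖iteratedDeriv i (g j) (ψ j w)‖ₑ * eLpNorm (ψ j) 2 P ^ i := fun j =>
      hilbertNorm_le_of_forall_eq (hψ j) (iteratedFDeriv_comp_dual (hgi j) (ψ j) w)
    by_cases hw : w ∈ U
    · rw [indicator_of_mem hw]
      calc ∑ j, hilbertNorm P (iteratedFDeriv ℝ i (fun w => g j (ψ j w)) w)
          ≤ ∑ _j : ι, (C : ℝ≥0∞) * (R : ℝ≥0∞) ^ N := by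
            refine Finset.sum_le_sum fun j _ => (hj j).trans ?_
            refine mul_le_mul' (hC j i hi _) ?_
            refine (pow_le_pow_left' (hψR j) i).trans (pow_le_pow_right₀ ?_ hi)
            exact_mod_cast hR
        _ = K := by simp [hK, mul_assoc]
    · refine le_trans (le_of_eq (Finset.sum_eq_zero fun j _ => ?_)) zero_le
      refine le_antisymm ((hj j).trans ?_) zero_le
      have : ψ j w < κ j := by
        by_contra hcon
        exact hw ⟨j, not_lt.1 hcon⟩
      simp [h0 j i hi _ this]
  have hint : ∀ i ∈ Finset.range (N + 1),
      ∫⁻ w, hilbertNorm P (iteratedFDeriv ℝ i (fun w => ∑ j, g j (ψ j w)) w) ^ q ∂P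
        ≤ K ^ q * P U := by
    intro i hi
    calc _ ≤ ∫⁻ w, U.indicator (fun _ => K ^ q) w ∂P := by
          refine lintegral_mono fun w => ?_
          refine (ENNReal.rpow_le_rpow (hpt i (by simpa [Nat.lt_succ_iff] using hi) w)
            hq0.le).trans ?_
          by_cases hw : w ∈ U <;> simp [hw, hq0]
      _ = K ^ q * P U := by rw [lintegral_indicator_const hUm]
  calc sobolevNorm P q N (fun w => ∑ j, g j (ψ j w))
      ≤ (∑ _i ∈ Finset.range (N + 1), K ^ q * P U) ^ (1 / q) :=
        ENNReal.rpow_le_rpow (Finset.sum_le_sum hint) (by positivity)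
    _ = _ := by
      rw [Finset.sum_const, Finset.card_range, nsmul_eq_mul, ← mul_assoc,
        ENNReal.mul_rpow_of_nonneg _ _ (by positivity : (0:ℝ) ≤ 1 / q)]
      push_cast
      rfl

/-- The `L^q` norm is bounded by the Sobolev norm. -/
theorem eLpNorm_le_sobolevNorm {P : Measure E} {q : ℝ} (hq : 1 < q) (N : ℕ) (F : E → ℝ) :
    eLpNorm F (ENNReal.ofReal q) P ≤ sobolevNorm P q N F := by
  have hq0 : 0 < q := by linarith
  rw [eLpNorm_eq_lintegral_rpow_enorm_toReal (by simpa using hq0) ENNReal.ofReal_ne_top,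
    ENNReal.toReal_ofReal hq0.le]
  refine ENNReal.rpow_le_rpow ?_ (by positivity)
  refine le_trans ?_ (Finset.single_le_sum (f := fun i =>
    ∫⁻ w, hilbertNorm P (iteratedFDeriv ℝ i F w) ^ q ∂P) (fun _ _ => zero_le)
    (Finset.mem_range.2 (Nat.succ_pos N)))
  exact lintegral_mono fun w => ENNReal.rpow_le_rpow (enorm_le_hilbertNorm_zero P F w) hq0.le

theorem aestronglyMeasurable_of_mem_smoothFunctionals [OpensMeasurableSpace E] {P : Measure E}
    {F : E → ℝ} (hF : F ∈ smoothFunctionals E) : AEStronglyMeasurable F P := by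
  refine Continuous.aestronglyMeasurable ?_
  refine Submodule.span_induction ?_ continuous_zero (fun _ _ _ _ h h' => h.add h')
    (fun c _ _ h => h.const_smul c) hF
  rintro F ⟨n, f, φ, hf⟩
  rw [show F = fun w => f (WithLp.toLp 2 fun j => φ j w) from funext hf]
  have h2 : Continuous fun w => WithLp.toLp 2 fun j => φ j w :=
    (PiLp.continuous_toLp 2 _).comp (continuous_pi fun j => (φ j).continuous)
  exact f.continuous.comp h2

theorem IsSobolev.eLpNorm_le [OpensMeasurableSpace E] {P : Measure E} {q : ℝ} (hq : 1 < q) {N : ℕ}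
    {u : E → ℝ} {c : ℝ≥0∞} (h : IsSobolev P q N u c) : eLpNorm u (ENNReal.ofReal q) P ≤ c := by
  obtain ⟨hu, F, hF, -, hlim, hc⟩ := h
  have h1 : Tendsto (fun k => sobolevNorm P q N (F k)
      + eLpNorm (F k - u) (ENNReal.ofReal q) P) atTop (𝓝 (c + 0)) := hc.add hlim
  rw [add_zero] at h1
  refine ge_of_tendsto' h1 fun k => ?_
  have hFk := aestronglyMeasurable_of_mem_smoothFunctionals (P := P) (hF k)
  calc eLpNorm u (ENNReal.ofReal q) P
      = eLpNorm (F k - (F k - u)) (ENNReal.ofReal q) P := by rw [sub_sub_cancel]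
    _ ≤ eLpNorm (F k) (ENNReal.ofReal q) P + eLpNorm (F k - u) (ENNReal.ofReal q) P :=
        eLpNorm_sub_le hFk (hFk.sub hu) (by simpa using hq.le)
    _ ≤ _ := by gcongr; exact eLpNorm_le_sobolevNorm hq N _

/-- Chebyshev's inequality: a competitor u is at least 1 on an open set containing A, so P(A) ≤
𝔼|u|^q, and the L^q norm is at most the Sobolev norm. -/
theorem measure_rpow_le_cap [OpensMeasurableSpace E] {P : Measure E} {q : ℝ} (hq : 1 < q) (N : ℕ)
    (A : Set E) : P A ^ (1 / q) ≤ cap P q N A := by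
  have hq0 : 0 < q := by linarith
  refine le_iInf fun O => le_iInf fun hO => le_iInf fun hAO => le_iInf fun u => le_iInf fun c =>
    le_iInf fun hu => le_iInf fun h1 => le_iInf fun _ => le_trans ?_ (hu.eLpNorm_le hq)
  rw [eLpNorm_eq_lintegral_rpow_enorm_toReal (by simpa using hq0) ENNReal.ofReal_ne_top,
    ENNReal.toReal_ofReal hq0.le]
  refine ENNReal.rpow_le_rpow ?_ (by positivity)
  calc P A ≤ P O := measure_mono hAO
    _ = ∫⁻ w, O.indicator (fun _ => 1) w ∂P := by rw [lintegral_indicator_const hO.measurableSet, one_mul]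
    _ ≤ _ := by
      refine lintegral_mono_ae ?_
      filter_upwards [h1] with w hw
      by_cases hwO : w ∈ O
      · rw [indicator_of_mem hwO]
        refine ENNReal.one_le_rpow ?_ hq0
        have := hw hwO
        rw [← ofReal_norm, ENNReal.one_le_ofReal]
        exact this.trans (le_abs_self _)
      · simp [hwO]

end Malliavin

/-! ### Smooth cutoff functions -/

section SmoothTransition

open Real (smoothTransition)

theorem iteratedDeriv_smoothTransition_of_neg (i : ℕ) {y : ℝ} (hy : y < 0) :
    iteratedDeriv i smoothTransition y = 0 := by
  have h : smoothTransition =ᶠ[𝓝 y] fun _ => (0 : ℝ) := by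
    filter_upwards [eventually_lt_nhds hy] with z hz
    exact Real.smoothTransition.zero_of_nonpos hz.le
  rw [h.iteratedDeriv_eq, iteratedDeriv_const]
  simp

theorem exists_enorm_iteratedDeriv_smoothTransition_le (N : ℕ) :
    ∃ C : ℝ≥0, ∀ i ≤ N, ∀ y, ‖iteratedDeriv i smoothTransition y‖ₑ ≤ C := by
  have key : ∀ i : ℕ, ∃ C : ℝ≥0, ∀ y, ‖iteratedDeriv i smoothTransition y‖ₑ ≤ C := by
    intro i
    have hcont : Continuous (iteratedDeriv i smoothTransition) :=
      (Real.smoothTransition.contDiff (n := i)).continuous_iteratedDeriv i le_rfl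
    obtain ⟨M, hM⟩ := (isCompact_Icc (a := (0 : ℝ)) (b := 1)).exists_bound_of_continuousOn
      hcont.continuousOn
    -- M bounds the derivative on [0,1]. To the left everything vanishes; to the right the function
    -- is 1, which accounts for the 1 when i = 0.
    refine ⟨(max M 1).toNNReal, fun y => ?_⟩
    rw [← ofReal_norm]
    refine ENNReal.ofReal_le_ofReal ?_
    rcases lt_or_ge y 0 with hy | hy
    · rw [iteratedDeriv_smoothTransition_of_neg i hy]
      simp
    rcases le_or_gt y 1 with hy1 | hy1
    · exact (hM y ⟨hy, hy1⟩).trans (le_max_left _ _)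
    · have h : smoothTransition =ᶠ[𝓝 y] fun _ => (1 : ℝ) := by
        filter_upwards [eventually_gt_nhds hy1] with z hz
        exact Real.smoothTransition.one_of_one_le hz.le
      rw [h.iteratedDeriv_eq, iteratedDeriv_const]
      split_ifs <;> simp
  choose C hC using key
  refine ⟨∑ i ∈ Finset.range (N + 1), C i, fun i hi y => (hC i y).trans ?_⟩
  exact_mod_cast Finset.single_le_sum (f := C) (fun _ _ => zero_le)
    (Finset.mem_range.2 (Nat.lt_succ_of_le hi))

/-- A smooth function which increases from `0` to `1` just after `a` and returns to `0` just
after `b`. -/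
noncomputable def plateau (a b y : ℝ) : ℝ := smoothTransition (y - a) - smoothTransition (y - b)

theorem contDiff_plateau (a b : ℝ) {n : ℕ∞} : ContDiff ℝ n (plateau a b) :=
  (Real.smoothTransition.contDiff.comp (contDiff_id.sub contDiff_const)).sub
    (Real.smoothTransition.contDiff.comp (contDiff_id.sub contDiff_const))

theorem iteratedDeriv_plateau (a b : ℝ) (i : ℕ) (y : ℝ) :
    iteratedDeriv i (plateau a b) y
      = iteratedDeriv i smoothTransition (y - a) - iteratedDeriv i smoothTransition (y - b) := by
  have h : ∀ c : ℝ, ContDiffAt ℝ i (fun y => smoothTransition (y - c)) y := fun c =>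
    (Real.smoothTransition.contDiff.comp (contDiff_id.sub contDiff_const)).contDiffAt
  rw [show plateau a b = fun y => smoothTransition (y - a) - smoothTransition (y - b) from rfl,
    iteratedDeriv_fun_sub (h a) (h b), iteratedDeriv_comp_sub_const, iteratedDeriv_comp_sub_const]

theorem enorm_iteratedDeriv_plateau_le {N : ℕ} {C : ℝ≥0}
    (hC : ∀ i ≤ N, ∀ y, ‖iteratedDeriv i smoothTransition y‖ₑ ≤ C) (a b : ℝ) {i : ℕ} (hi : i ≤ N)
    (y : ℝ) : ‖iteratedDeriv i (plateau a b) y‖ₑ ≤ (2 * C : ℝ≥0) := by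
  rw [iteratedDeriv_plateau]
  refine (enorm_sub_le).trans ((add_le_add (hC i hi _) (hC i hi _)).trans_eq ?_)
  push_cast
  ring

/-- No order between a and b is imposed, because differences of two truncations produce plateaus
with the endpoints in either order. -/
theorem iteratedDeriv_plateau_of_lt {a b y κ : ℝ} (ha : κ ≤ a) (hb : κ ≤ b) (hy : y < κ) (i : ℕ) :
    iteratedDeriv i (plateau a b) y = 0 := by
  rw [iteratedDeriv_plateau, iteratedDeriv_smoothTransition_of_neg i (by linarith),
    iteratedDeriv_smoothTransition_of_neg i (by linarith), sub_zero]

theorem plateau_eq_zero {a b y : ℝ} (hab : a ≤ b) (hy : y ∉ Icc a (b + 1)) :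
    plateau a b y = 0 := by
  rw [plateau]
  rcases lt_or_ge y a with h | h
  · rw [Real.smoothTransition.zero_of_nonpos (by linarith),
      Real.smoothTransition.zero_of_nonpos (by linarith), sub_zero]
  · have h' : b + 1 < y := by
      by_contra hcon
      exact hy ⟨h, not_lt.1 hcon⟩
    rw [Real.smoothTransition.one_of_one_le (by linarith),
      Real.smoothTransition.one_of_one_le (by linarith), sub_self]

end SmoothTransition

/-! ### Capacity of finite unions of half-spaces -/

section Capacity

open Real (smoothTransition)

/-- The transition function itself is not Schwartz, as it stays at 1; returning to 0 makes the
support compact, so plateaus can approximate it. -/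
theorem plateau_comp_mem_smoothFunctionals {E : Type*} [NormedAddCommGroup E] [NormedSpace ℝ E]
    (ψ : StrongDual ℝ E) {a b : ℝ} (hab : a ≤ b) :
    (fun w => plateau a b (ψ w)) ∈ smoothFunctionals E := by
  set f : EuclideanSpace ℝ (Fin 1) → ℝ := fun x => plateau a b (x 0) with hf
  have h1 : HasCompactSupport f := by
    refine HasCompactSupport.intro (isCompact_closedBall (0 : EuclideanSpace ℝ (Fin 1))
      (|a| + |b + 1|)) fun x hx => plateau_eq_zero hab fun hx' => hx ?_
    rw [mem_closedBall_zero_iff, EuclideanSpace.norm_eq]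
    simp only [Finset.univ_unique, Fin.default_eq_zero, Finset.sum_singleton, Real.norm_eq_abs]
    rw [Real.sqrt_sq (abs_nonneg _), abs_le]
    have := neg_abs_le a
    have := le_abs_self (b + 1)
    have := abs_nonneg a
    have := abs_nonneg (b + 1)
    exact ⟨by linarith [hx'.1], by linarith [hx'.2]⟩
  have h2 : ContDiff ℝ ((⊤ : ℕ∞) : WithTop ℕ∞) f :=
    (contDiff_plateau a b).comp (EuclideanSpace.proj (𝕜 := ℝ) (0 : Fin 1)).contDiff
  exact Submodule.subset_span ⟨1, h1.toSchwartzMap h2, fun _ => ψ, fun w => rfl⟩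

variable {E : Type*} [NormedAddCommGroup E] [NormedSpace ℝ E] [MeasurableSpace E]

/-- Continuity from above, since a fixed w leaves the events once k is large. This makes the
truncated test functions Cauchy. -/
theorem tendsto_measure_exists_add_le [OpensMeasurableSpace E] (P : Measure E) [IsFiniteMeasure P]
    {ι : Type*} [Fintype ι] (ψ : ι → StrongDual ℝ E) (c : ι → ℝ) :
    Tendsto (fun k : ℕ => P {w | ∃ j, c j + k ≤ ψ j w}) atTop (𝓝 0) := by
  have hm : ∀ k : ℕ, MeasurableSet {w | ∃ j, c j + k ≤ ψ j w} := by
    intro k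
    have : {w | ∃ j, c j + k ≤ ψ j w} = ⋃ j, {w | c j + k ≤ ψ j w} := by ext; simp
    rw [this]
    exact MeasurableSet.iUnion fun j => (isClosed_le continuous_const (ψ j).continuous).measurableSet
  have hanti : Antitone fun k : ℕ => {w | ∃ j, c j + k ≤ ψ j w} := by
    rintro k l hkl w ⟨j, hj⟩
    have : (k : ℝ) ≤ l := by exact_mod_cast hkl
    exact ⟨j, by linarith⟩
  have hempty : ⋂ k : ℕ, {w | ∃ j, c j + k ≤ ψ j w} = ∅ := by
    refine eq_empty_of_forall_notMem fun w hw => ?_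
    obtain ⟨k, hk⟩ := exists_nat_gt (∑ j, |ψ j w - c j|)
    obtain ⟨j, hj⟩ := mem_iInter.1 hw k
    have h1 := Finset.single_le_sum (f := fun j => |ψ j w - c j|) (fun _ _ => abs_nonneg _)
      (Finset.mem_univ j)
    have h2 := le_abs_self (ψ j w - c j)
    linarith
  have := tendsto_measure_iInter_atTop (μ := P) (fun k => (hm k).nullMeasurableSet) hanti
    ⟨0, measure_ne_top _ _⟩
  rwa [hempty, measure_empty] at this

/-- The capacity of a finite union of half-spaces is controlled by the probability of a slightly
larger finite union of half-spaces. -/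
theorem exists_cap_halfSpaces_le [OpensMeasurableSpace E] (P : Measure E) [IsFiniteMeasure P]
    {q : ℝ} (hq : 1 < q) (N : ℕ) (ι : Type*) [Fintype ι] {R : ℝ≥0} (hR : 1 ≤ R) :
    ∃ K : ℝ≥0∞, K ≠ ∞ ∧ ∀ (ψ : ι → StrongDual ℝ E) (c : ι → ℝ), (∀ j, MemLp (ψ j) 2 P) →
      (∀ j, eLpNorm (ψ j) 2 P ≤ R) →
      cap P q N {w | ∃ j, c j + 1 < ψ j w} ≤ K * P {w | ∃ j, c j ≤ ψ j w} ^ (1 / q) := by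
  obtain ⟨C, hC⟩ := exists_enorm_iteratedDeriv_smoothTransition_le N
  have hq0 : 0 < q := by linarith
  -- K sees the functionals only through R and is independent of the thresholds, so one K serves all
  -- small ε. The factor 2 comes from the two transitions of a plateau.
  set K : ℝ≥0∞ := (((N : ℝ≥0∞) + 1) * (Fintype.card ι * (2 * C : ℝ≥0) * R ^ N) ^ q) ^ (1 / q)
    with hK
  have hKtop : K ≠ ∞ := by
    refine ENNReal.rpow_ne_top_of_nonneg (by positivity) (ENNReal.mul_ne_top (by simp) ?_)
    refine ENNReal.rpow_ne_top_of_nonneg hq0.le (ENNReal.mul_ne_top (ENNReal.mul_ne_top (by simp)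
      ENNReal.coe_ne_top) (by simp))
  refine ⟨K, hKtop, fun ψ c hψ hψR => ?_⟩
  set U : ℕ → Set E := fun k => {w | ∃ j, c j + k ≤ ψ j w} with hU
  have hUanti : Antitone U := by
    rintro k l hkl w ⟨j, hj⟩
    have : (k : ℝ) ≤ l := by exact_mod_cast hkl
    exact ⟨j, by linarith⟩
  have hU0 : U 0 = {w | ∃ j, c j ≤ ψ j w} := by simp [hU]
  rw [← hU0]
  have hUlim : Tendsto (fun k => P (U k) ^ (1 / q)) atTop (𝓝 0) := by
    have := (ENNReal.continuous_rpow_const (y := 1 / q)).tendsto 0 |>.comp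
      (tendsto_measure_exists_add_le P ψ c)
    rwa [ENNReal.zero_rpow_of_pos (by positivity)] at this
  have hbound : ∀ k l n : ℕ, n ≤ k → n ≤ l →
      sobolevNorm P q N (fun w => ∑ j, plateau (c j + k) (c j + l) (ψ j w))
        ≤ K * P (U n) ^ (1 / q) := by
    intro k l n hk hl
    have hk' : (n : ℝ) ≤ k := by exact_mod_cast hk
    have hl' : (n : ℝ) ≤ l := by exact_mod_cast hl
    exact sobolevNorm_sum_comp_dual_le hq hR (κ := fun j => c j + n)
      (fun j => contDiff_plateau (n := N) _ _) hψ hψR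
      (fun j i hi y => enorm_iteratedDeriv_plateau_le hC _ _ hi y)
      (fun j i _ y hy => iteratedDeriv_plateau_of_lt (by linarith) (by linarith) hy i)
  -- The test function is u below. F k truncates it by switching the j-th summand off again after c
  -- j + k.
  set F : ℕ → E → ℝ := fun k w => ∑ j, plateau (c j) (c j + k) (ψ j w) with hF
  set u : E → ℝ := fun w => ∑ j, smoothTransition (ψ j w - c j) with hu
  have hFS : ∀ k, F k ∈ smoothFunctionals E := by
    intro k
    have : F k = ∑ j, fun w => plateau (c j) (c j + k) (ψ j w) := by
      ext w
      simp [hF]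
    rw [this]
    exact Submodule.sum_mem _ fun j _ => plateau_comp_mem_smoothFunctionals (ψ j) (by simp)
  have hFsub : ∀ k l, F k - F l = fun w => ∑ j, plateau (c j + l) (c j + k) (ψ j w) := by
    intro k l
    ext w
    simp only [hF, Pi.sub_apply, ← Finset.sum_sub_distrib, plateau]
    refine Finset.sum_congr rfl fun j _ => ?_
    ring
  -- `IsSobolev` asks for the norms to converge; compactness of [0,∞] supplies a subsequence along
  -- which they do.
  obtain ⟨a, φ, hφ, ha⟩ := CompactSpace.tendsto_subseq fun k => sobolevNorm P q N (F k)
  have haK : a ≤ K * P (U 0) ^ (1 / q) := by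
    refine le_of_tendsto' ha fun k => ?_
    have := hbound 0 (φ k) 0 le_rfl (Nat.zero_le _)
    simpa [hF] using this
  refine le_trans ?_ haK
  have hopen : IsOpen {w | ∃ j, c j + 1 < ψ j w} := by
    have : {w | ∃ j, c j + 1 < ψ j w} = ⋃ j, {w | c j + 1 < ψ j w} := by ext; simp
    rw [this]
    exact isOpen_iUnion fun j => isOpen_lt continuous_const (ψ j).continuous
  refine (iInf₂_le_of_le _ hopen (iInf_le_of_le Subset.rfl le_rfl) : cap P q N _ ≤ _).trans ?_
  have hucont : Continuous u := continuous_finsetSum _ fun j _ =>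
    Real.smoothTransition.continuous.comp ((ψ j).continuous.sub continuous_const)
  have hS : IsSobolev P q N u a := by
    refine ⟨hucont.aestronglyMeasurable, F ∘ φ, fun k => hFS _, fun η hη => ?_, ?_, ha⟩
    · have h1 : Tendsto (fun k => K * P (U k) ^ (1 / q)) atTop (𝓝 0) := by
        simpa using ENNReal.Tendsto.const_mul hUlim (Or.inr hKtop)
      obtain ⟨n, hn⟩ := (h1.eventually (ge_mem_nhds hη)).exists
      refine ⟨n, fun k hk l hl => ?_⟩
      simp only [Function.comp_apply]
      rw [hFsub]
      exact (hbound _ _ n (hl.trans hφ.le_apply) (hk.trans hφ.le_apply)).trans hn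
    · have h2 : Tendsto (fun k => eLpNorm (F k - u) (ENNReal.ofReal q) P) atTop (𝓝 0) := by
        have h1 : Tendsto (fun k => (Fintype.card ι : ℝ≥0∞) * P (U k) ^ (1 / q)) atTop (𝓝 0) := by
          simpa using ENNReal.Tendsto.const_mul hUlim (Or.inr (by simp))
        refine tendsto_of_tendsto_of_tendsto_of_le_of_le tendsto_const_nhds h1
          (fun _ => zero_le) fun k => ?_
        have hUm : MeasurableSet (U k) := by
          have : U k = ⋃ j, {w | c j + k ≤ ψ j w} := by ext; simp [hU]
          rw [this]
          exact MeasurableSet.iUnion fun j =>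
            (isClosed_le continuous_const (ψ j).continuous).measurableSet
        calc eLpNorm (F k - u) (ENNReal.ofReal q) P
            ≤ eLpNorm ((U k).indicator fun _ => (Fintype.card ι : ℝ)) (ENNReal.ofReal q) P := by
              refine eLpNorm_mono fun w => ?_
              -- The truncation error is the sum of the second transitions, which lives on U k and
              -- is at most the number of functionals.
              have e : (F k - u) w = -∑ j, smoothTransition (ψ j w - (c j + k)) := by
                simp [hF, hu, plateau]
              rw [e, norm_neg]
              by_cases hw : w ∈ U k
              · rw [indicator_of_mem hw]
                refine (norm_sum_le _ _).trans ?_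
                have hle : ∀ j ∈ (Finset.univ : Finset ι),
                    ‖smoothTransition (ψ j w - (c j + k))‖ ≤ 1 := by
                  intro j _
                  rw [Real.norm_of_nonneg (Real.smoothTransition.nonneg _)]
                  exact Real.smoothTransition.le_one _
                refine (Finset.sum_le_sum hle).trans_eq ?_
                simp
              · rw [indicator_of_notMem hw, Finset.sum_eq_zero]
                intro j _
                refine Real.smoothTransition.zero_of_nonpos ?_
                by_contra hcon
                exact hw ⟨j, by linarith⟩
          _ = _ := by
              rw [eLpNorm_indicator_const hUm (by simpa using hq0) ENNReal.ofReal_ne_top,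
                ENNReal.toReal_ofReal hq0.le]
              simp
      exact h2.comp hφ.tendsto_atTop
  refine iInf₂_le_of_le u a (iInf₂_le_of_le hS (ae_of_all _ ?_) (iInf_le_of_le (ae_of_all _ ?_)
    le_rfl))
  · rintro w ⟨j, hj⟩
    have h1 := Finset.single_le_sum (f := fun j => smoothTransition (ψ j w - c j))
      (fun _ _ => Real.smoothTransition.nonneg _) (Finset.mem_univ j)
    simp only [Real.smoothTransition.one_of_one_le (show 1 ≤ ψ j w - c j by linarith)] at h1
    exact h1
  · intro w
    exact Finset.sum_nonneg fun j _ => Real.smoothTransition.nonneg _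

end Capacity

/-! ### Coordinate boxes in finite dimension -/

section Coordinates

variable {F : Type*} [NormedAddCommGroup F] [NormedSpace ℝ F] [FiniteDimensional ℝ F]

variable (F) in
/-- The coordinates of a finite-dimensional space with respect to a fixed basis. -/
noncomputable def coordEquiv : F ≃L[ℝ] (Fin (Module.finrank ℝ F) → ℝ) :=
  (Module.finBasis ℝ F).equivFunL

/-- A coordinate functional of a finite-dimensional space. -/
noncomputable def coordDual (i : Fin (Module.finrank ℝ F)) : StrongDual ℝ F :=
  (ContinuousLinearMap.proj (R := ℝ) (φ := fun _ => ℝ) i).comp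
    (coordEquiv F : F →L[ℝ] Fin (Module.finrank ℝ F) → ℝ)

theorem isCompact_setOf_abs_coordDual_le (R : Fin (Module.finrank ℝ F) → ℝ) :
    IsCompact {x : F | ∀ i, |coordDual i x| ≤ R i} := by
  have h : {x : F | ∀ i, |coordDual i x| ≤ R i} = coordEquiv F ⁻¹' (Icc (-R) R) := by
    ext x
    simp only [mem_ofPred_eq, mem_preimage, mem_Icc, Pi.le_def, abs_le, ← forall_and]
    rfl
  rw [h]
  exact (coordEquiv F).toHomeomorph.isCompact_preimage.2 isCompact_Icc

end Coordinates

/-! ### Finite-dimensional Gaussian measures: rate function and tail bounds -/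

section Gaussian

variable {F : Type*} [NormedAddCommGroup F] [NormedSpace ℝ F] [FiniteDimensional ℝ F]
  [MeasurableSpace F] [BorelSpace F] [SecondCountableTopology F] {ν : Measure F} [IsGaussian ν]

theorem coeFn_dual_toLp (φ : StrongDual ℝ F) : StrongDual.toLp ν 2 φ =ᵐ[ν] φ := by
  rw [StrongDual.toLp_apply IsGaussian.memLp_two_id]
  exact MemLp.coeFn_toLp _

theorem inner_dual_toLp (φ ψ : StrongDual ℝ F) :
    inner ℝ (StrongDual.toLp ν 2 φ) (StrongDual.toLp ν 2 ψ) = ∫ y, φ y * ψ y ∂ν := by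
  rw [L2.inner_def]
  refine integral_congr_ae ?_
  filter_upwards [coeFn_dual_toLp (ν := ν) φ, coeFn_dual_toLp (ν := ν) ψ] with y h1 h2
  rw [h1, h2]
  simp [mul_comm]

theorem norm_dual_toLp_sq (φ : StrongDual ℝ F) :
    ‖StrongDual.toLp ν 2 φ‖ ^ 2 = ∫ y, φ y ^ 2 ∂ν := by
  rw [← real_inner_self_eq_norm_sq, inner_dual_toLp]
  simp only [sq]

/-- In finite dimension the functionals form a finite-dimensional, hence closed, subspace of L², so
every Z is represented by a functional. -/
theorem firstChaos_eq_range :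
    firstChaos ν = LinearMap.range (StrongDual.toLp (𝕜 := ℝ) ν 2).toLinearMap := by
  have h : {Z : Lp ℝ 2 ν | ∃ φ : StrongDual ℝ F, Z =ᵐ[ν] fun w => φ w}
      = LinearMap.range (StrongDual.toLp (𝕜 := ℝ) ν 2).toLinearMap := by
    ext Z
    constructor
    · rintro ⟨φ, hφ⟩
      exact ⟨φ, Lp.ext ((coeFn_dual_toLp φ).trans hφ.symm)⟩
    · rintro ⟨φ, rfl⟩
      exact ⟨φ, coeFn_dual_toLp φ⟩
  rw [firstChaos, h]
  exact (Submodule.closed_of_finiteDimensional _).closure_eq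

theorem IsCameronMartin.apply_eq_inner {Z : Lp ℝ 2 ν} {x : F} (h : IsCameronMartin ν Z x)
    (φ : StrongDual ℝ F) : φ x = inner ℝ Z (StrongDual.toLp ν 2 φ) := by
  rw [h.2 φ, L2.inner_def]
  refine integral_congr_ae ?_
  filter_upwards [coeFn_dual_toLp (ν := ν) φ] with y h1
  rw [h1]
  simp [mul_comm]

theorem isCameronMartin_of_forall_inner {φ : StrongDual ℝ F} {x : F}
    (h : ∀ ψ : StrongDual ℝ F, ψ x = inner ℝ (StrongDual.toLp ν 2 φ) (StrongDual.toLp ν 2 ψ)) :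
    IsCameronMartin ν (StrongDual.toLp ν 2 φ) x := by
  refine ⟨?_, fun ψ => ?_⟩
  · rw [firstChaos_eq_range]
    exact ⟨φ, rfl⟩
  · rw [h ψ, inner_dual_toLp]
    refine integral_congr_ae ?_
    filter_upwards [coeFn_dual_toLp (ν := ν) φ] with y h1
    rw [h1]

/-- The inequality forces evaluation at x to vanish on functionals that are null in L², even for
degenerate ν. It thus descends to the image of the dual in L², where Riesz represents it by some φ₀;
testing with φ₀ itself gives ‖φ₀‖⁴ ≤ 2β‖φ₀‖². -/
theorem gaussianRate_le_of_forall {x : F} {β : ℝ} (hβ : 0 ≤ β)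
    (h : ∀ φ : StrongDual ℝ F, φ x ^ 2 ≤ 2 * β * ‖StrongDual.toLp ν 2 φ‖ ^ 2) :
    gaussianRate ν x ≤ ENNReal.ofReal β := by
  set Λ : StrongDual ℝ F →ₗ[ℝ] Lp ℝ 2 ν := (StrongDual.toLp (𝕜 := ℝ) ν 2).toLinearMap with hΛ
  have hex : ∃ g : Lp ℝ 2 ν →ₗ[ℝ] ℝ, ∀ φ : StrongDual ℝ F, g (Λ φ) = φ x := by
    let ev : StrongDual ℝ F →ₗ[ℝ] ℝ :=
      { toFun := fun φ => φ x, map_add' := fun _ _ => rfl, map_smul' := fun _ _ => rfl }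
    have hmem : ev ∈ LinearMap.range Λ.dualMap := by
      rw [LinearMap.range_dualMap_eq_dualAnnihilator_ker, Submodule.mem_dualAnnihilator]
      intro φ hφ
      have h0 : StrongDual.toLp ν 2 φ = 0 := hφ
      have := h φ
      rw [h0] at this
      have h2 : φ x ^ 2 ≤ 0 := by simpa using this
      exact pow_eq_zero_iff two_ne_zero |>.1 (le_antisymm h2 (sq_nonneg _))
    obtain ⟨g, hg⟩ := hmem
    exact ⟨g, fun φ => LinearMap.congr_fun hg φ⟩
  obtain ⟨g, hg⟩ := hex
  set K := LinearMap.range Λ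
  let gK : StrongDual ℝ K := LinearMap.toContinuousLinearMap (g ∘ₗ K.subtype)
  obtain ⟨φ₀, hφ₀⟩ := ((InnerProductSpace.toDual ℝ K).symm gK).2
  have hin : ∀ ψ : StrongDual ℝ F, ψ x = inner ℝ (Λ φ₀) (Λ ψ) := by
    intro ψ
    have := InnerProductSpace.toDual_symm_apply (𝕜 := ℝ) (x := (⟨Λ ψ, ψ, rfl⟩ : K)) (y := gK)
    rw [Submodule.coe_inner, ← hφ₀] at this
    rw [this]
    exact (hg ψ).symm
  have hCM : IsCameronMartin ν (Λ φ₀) x := isCameronMartin_of_forall_inner hin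
  refine iInf₂_le_of_le _ hCM (ENNReal.ofReal_le_ofReal ?_)
  have h1 : φ₀ x = ‖Λ φ₀‖ ^ 2 := by rw [hin, real_inner_self_eq_norm_sq]
  have h2 : φ₀ x ^ 2 ≤ 2 * β * ‖Λ φ₀‖ ^ 2 := h φ₀
  rw [h1] at h2
  rcases (sq_nonneg ‖Λ φ₀‖).eq_or_lt with h0 | h0
  · rwa [← h0, zero_div]
  · nlinarith

/-- Cauchy–Schwarz applied to φ(x) = ⟨Z, φ⟩, with Z nearly attaining the infimum. Together with
`gaussianRate_le_of_forall` this describes the level sets by linear functionals. -/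
theorem sq_le_of_gaussianRate_le {x : F} {β : ℝ} (hβ : 0 ≤ β)
    (h : gaussianRate ν x ≤ ENNReal.ofReal β) (φ : StrongDual ℝ F) :
    φ x ^ 2 ≤ 2 * β * ‖StrongDual.toLp ν 2 φ‖ ^ 2 := by
  refine le_of_forall_pos_le_add fun ε hε => ?_
  set s := ‖StrongDual.toLp ν 2 φ‖ with hs
  -- The excess 2δs² then stays below ε; the added 1 covers s = 0.
  set δ := ε / (2 * s ^ 2 + 1) with hδ
  have hδ0 : 0 < δ := by positivity
  have hlt : gaussianRate ν x < ENNReal.ofReal (β + δ) :=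
    h.trans_lt ((ENNReal.ofReal_lt_ofReal_iff (by linarith)).2 (by linarith))
  obtain ⟨Z, hZ⟩ := iInf_lt_iff.1 hlt
  obtain ⟨hCM, hZ⟩ := iInf_lt_iff.1 hZ
  have hZ' : ‖Z‖ ^ 2 / 2 < β + δ := (ENNReal.ofReal_lt_ofReal_iff (by linarith)).1 hZ
  have h1 : |φ x| ≤ ‖Z‖ * s := by
    rw [hCM.apply_eq_inner]
    exact abs_real_inner_le_norm _ _
  have h2 : φ x ^ 2 ≤ (‖Z‖ * s) ^ 2 := by
    rw [← sq_abs]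
    exact pow_le_pow_left₀ (abs_nonneg _) h1 2
  have h3 : δ * (2 * s ^ 2 + 1) = ε := by
    rw [hδ]
    field_simp
  have h4 : ‖Z‖ ^ 2 * s ^ 2 ≤ 2 * (β + δ) * s ^ 2 := by
    have := sq_nonneg s
    gcongr
    linarith
  nlinarith

/-- By the dual description the level set is an intersection of closed sets, and the coordinate
functionals confine it to a box. -/
theorem isCompact_gaussianRate_le {β : ℝ} (hβ : 0 ≤ β) :
    IsCompact {x | gaussianRate ν x ≤ ENNReal.ofReal β} := by
  have h : {x | gaussianRate ν x ≤ ENNReal.ofReal β}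
      = ⋂ φ : StrongDual ℝ F, {x | φ x ^ 2 ≤ 2 * β * ‖StrongDual.toLp ν 2 φ‖ ^ 2} := by
    ext x
    rw [mem_iInter]
    exact ⟨fun hx => sq_le_of_gaussianRate_le hβ hx, gaussianRate_le_of_forall hβ⟩
  have hcl : IsClosed {x | gaussianRate ν x ≤ ENNReal.ofReal β} := by
    rw [h]
    exact isClosed_iInter fun φ => isClosed_le (φ.continuous.pow 2) continuous_const
  refine (isCompact_setOf_abs_coordDual_le fun i =>
    √(2 * β * ‖StrongDual.toLp ν 2 (coordDual (F := F) i)‖ ^ 2)).of_isClosed_subset hcl ?_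
  intro x hx i
  exact Real.abs_le_sqrt (sq_le_of_gaussianRate_le hβ hx _)

/-- Some φ violates the dual inequality at x, and its sign can be chosen so that φ(x) > 0. The
condition on c is homogeneous in (ψ, c), so rescaling buys the margin 1. -/
theorem exists_halfSpace_of_lt_gaussianRate {x : F} {a : ℝ} (ha : 0 ≤ a)
    (hx : ENNReal.ofReal a < gaussianRate ν x) :
    ∃ (ψ : StrongDual ℝ F) (c : ℝ), 0 < c ∧ 2 * a * ‖StrongDual.toLp ν 2 ψ‖ ^ 2 ≤ c ^ 2 ∧
      c + 1 < ψ x := by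
  have h1 : ∃ φ : StrongDual ℝ F, 2 * a * ‖StrongDual.toLp ν 2 φ‖ ^ 2 < φ x ^ 2 := by
    by_contra! hcon
    exact absurd (gaussianRate_le_of_forall ha hcon) (not_le.2 hx)
  have h2 : ∃ φ : StrongDual ℝ F, 2 * a * ‖StrongDual.toLp ν 2 φ‖ ^ 2 < φ x ^ 2 ∧ 0 < φ x := by
    obtain ⟨φ, hφ⟩ := h1
    have hne : φ x ≠ 0 := by
      intro h0
      rw [h0] at hφ
      have : 0 ≤ 2 * a * ‖StrongDual.toLp ν 2 φ‖ ^ 2 := by positivity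
      linarith
    rcases hne.lt_or_gt with h | h
    · exact ⟨-φ, by simpa using hφ, by simpa using h⟩
    · exact ⟨φ, hφ, h⟩
  obtain ⟨φ, hφ, hpos⟩ := h2
  set r := √(2 * a * ‖StrongDual.toLp ν 2 φ‖ ^ 2) with hr
  have hr0 : 0 ≤ r := Real.sqrt_nonneg _
  have hr2 : r ^ 2 = 2 * a * ‖StrongDual.toLp ν 2 φ‖ ^ 2 := Real.sq_sqrt (by positivity)
  have hrx : r < φ x := by
    rw [hr, Real.sqrt_lt' hpos]
    exact hφ
  set b := (r + φ x) / 2 with hb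
  have hbx : 0 < φ x - b := by rw [hb]; linarith
  -- b is midway between the critical threshold r and φ(x); this scaling turns the remaining gap
  -- into 2, more than the required 1.
  set t := 2 / (φ x - b) with ht
  have ht0 : 0 < t := by positivity
  refine ⟨t • φ, t * b, mul_pos ht0 (by rw [hb]; linarith), ?_, ?_⟩
  · rw [map_smul, norm_smul, mul_pow, mul_pow, Real.norm_eq_abs, sq_abs,
      show 2 * a * (t ^ 2 * ‖StrongDual.toLp ν 2 φ‖ ^ 2) = t ^ 2 * r ^ 2 by rw [hr2]; ring]
    gcongr
    rw [hb]
    linarith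
  · have : t * (φ x - b) = 2 := by rw [ht]; field_simp
    simp only [smul_apply, smul_eq_mul]
    linarith

/-- A closed set on which the rate function exceeds `a` is covered by finitely many half-spaces
whose Gaussian measure is at most `e^{-a}`, with a uniform margin. -/
theorem exists_finset_halfSpaces {A : Set F} (hA : IsClosed A) {a : ℝ} (ha : 0 ≤ a)
    (hAa : ∀ x ∈ A, ENNReal.ofReal a < gaussianRate ν x) :
    ∃ s : Finset (StrongDual ℝ F × ℝ),
      (∀ p ∈ s, 0 < p.2 ∧ 2 * a * ‖StrongDual.toLp ν 2 p.1‖ ^ 2 ≤ p.2 ^ 2) ∧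
      ∀ x ∈ A, ∃ p ∈ s, p.2 + 1 < p.1 x := by
  classical
  set good : Set (StrongDual ℝ F × ℝ) :=
    {p | 0 < p.2 ∧ 2 * a * ‖StrongDual.toLp ν 2 p.1‖ ^ 2 ≤ p.2 ^ 2} with hgood
  -- Half-spaces in the directions of plus and minus each coordinate will cover the part of A
  -- outside a compact box. The added 1 keeps c i positive even if a or the variance is 0.
  set c : Fin (Module.finrank ℝ F) → ℝ := fun i =>
    √(2 * a * ‖StrongDual.toLp ν 2 (coordDual (F := F) i)‖ ^ 2) + 1 with hc
  have hc1 : ∀ i, 1 ≤ c i := fun i => by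
    have := Real.sqrt_nonneg (2 * a * ‖StrongDual.toLp ν 2 (coordDual (F := F) i)‖ ^ 2)
    simp only [hc]
    linarith
  have hc2 : ∀ i, 2 * a * ‖StrongDual.toLp ν 2 (coordDual (F := F) i)‖ ^ 2 ≤ c i ^ 2 := fun i => by
    have h1 := Real.sqrt_nonneg (2 * a * ‖StrongDual.toLp ν 2 (coordDual (F := F) i)‖ ^ 2)
    have h2 := Real.sq_sqrt
      (show 0 ≤ 2 * a * ‖StrongDual.toLp ν 2 (coordDual (F := F) i)‖ ^ 2 by positivity)
    simp only [hc]
    nlinarith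
  have hK := (isCompact_setOf_abs_coordDual_le fun i => c i + 1).inter_right hA
  obtain ⟨t, ht⟩ := hK.elim_finite_subcover
    (fun p : good => {x | p.1.2 + 1 < p.1.1 x})
    (fun p => isOpen_lt continuous_const p.1.1.continuous) (by
      rintro x ⟨-, hxA⟩
      obtain ⟨ψ, b, hb, hb2, hx⟩ := exists_halfSpace_of_lt_gaussianRate ha (hAa x hxA)
      exact mem_iUnion.2 ⟨⟨(ψ, b), hb, hb2⟩, hx⟩)
  refine ⟨t.image Subtype.val ∪ (Finset.univ.image (fun i => (coordDual i, c i))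
    ∪ Finset.univ.image fun i => (-coordDual i, c i)), fun p hp => ?_, fun x hx => ?_⟩
  · rw [Finset.mem_union, Finset.mem_union] at hp
    rcases hp with hp | hp | hp
    · obtain ⟨p, -, rfl⟩ := Finset.mem_image.1 hp
      exact p.2
    · obtain ⟨i, -, rfl⟩ := Finset.mem_image.1 hp
      exact ⟨by linarith [hc1 i], hc2 i⟩
    · obtain ⟨i, -, rfl⟩ := Finset.mem_image.1 hp
      exact ⟨by linarith [hc1 i], by simpa only [map_neg, norm_neg] using hc2 i⟩
  · by_cases hbox : ∀ i, |coordDual i x| ≤ c i + 1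
    · obtain ⟨p, hp, hxp⟩ := mem_iUnion₂.1 (ht ⟨hbox, hx⟩)
      exact ⟨p.1, Finset.mem_union_left _ (Finset.mem_image_of_mem _ hp), hxp⟩
    · push Not at hbox
      obtain ⟨i, hi⟩ := hbox
      rcases lt_abs.1 hi with h | h
      · exact ⟨(coordDual i, c i), Finset.mem_union_right _ (Finset.mem_union_left _
          (Finset.mem_image_of_mem _ (Finset.mem_univ i))), h⟩
      · exact ⟨(-coordDual i, c i), Finset.mem_union_right _ (Finset.mem_union_right _
          (Finset.mem_image_of_mem (fun i => (-coordDual i, c i)) (Finset.mem_univ i))),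
          by simpa using h⟩

theorem map_dual_eq_gaussianReal (hν : ∀ φ : StrongDual ℝ F, ∫ y, φ y ∂ν = 0)
    (φ : StrongDual ℝ F) :
    ν.map φ = gaussianReal 0 (‖StrongDual.toLp ν 2 φ‖ ^ 2).toNNReal := by
  rw [IsGaussian.map_eq_gaussianReal, hν, norm_dual_toLp_sq,
    variance_of_integral_eq_zero φ.continuous.aemeasurable (hν φ)]

/-- Chernoff's bound with the Gaussian moment generating function. -/
theorem measure_halfSpace_le (hν : ∀ φ : StrongDual ℝ F, ∫ y, φ y ∂ν = 0) {φ : StrongDual ℝ F}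
    {a c ε : ℝ} (ha : 0 ≤ a) (hc : 0 < c) (hac : 2 * a * ‖StrongDual.toLp ν 2 φ‖ ^ 2 ≤ c ^ 2)
    (hε : 0 < ε) : ν {y | c ≤ ε * φ y} ≤ ENNReal.ofReal (Real.exp (-(a / ε ^ 2))) := by
  set Q := ‖StrongDual.toLp ν 2 φ‖ ^ 2 with hQ
  have hQ0 : 0 ≤ Q := by positivity
  have hlaw := map_dual_eq_gaussianReal hν φ
  rw [← hQ] at hlaw
  -- This is the optimal parameter c/(εQ) when 2aQ = c², written without dividing by Q, which may be
  -- 0. It contributes −2a/ε² and at most +a/ε² to the exponent.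
  set t := 2 * a / (c * ε) with ht
  have hint : Integrable (fun y => Real.exp (t * φ y)) ν := by
    have := integrable_exp_mul_gaussianReal (μ := 0) (v := Q.toNNReal) t
    rw [← hlaw] at this
    exact (integrable_map_measure (by fun_prop) φ.continuous.aemeasurable).1 this
  have hch := measure_ge_le_exp_mul_mgf (μ := ν) (X := φ) (c / ε) (t := t) (by positivity) hint
  rw [mgf_gaussianReal hlaw, Real.coe_toNNReal _ hQ0, ← Real.exp_add] at hch
  have hset : {y | c ≤ ε * φ y} = {y | c / ε ≤ φ y} := by
    ext y
    simp only [mem_ofPred_eq]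
    rw [div_le_iff₀ hε, mul_comm]
  rw [hset, ← ENNReal.ofReal_toReal (measure_ne_top ν _)]
  refine ENNReal.ofReal_le_ofReal (hch.trans (Real.exp_le_exp.2 ?_))
  have e1 : -t * (c / ε) = -(2 * (a / ε ^ 2)) := by
    rw [ht]
    field_simp
  have e2 : (0 : ℝ) * t + Q * t ^ 2 / 2 = (2 * a * Q) * (a / (c ^ 2 * ε ^ 2)) := by
    rw [ht]
    field_simp
    ring
  have e3 : c ^ 2 * (a / (c ^ 2 * ε ^ 2)) = a / ε ^ 2 := by field_simp
  have e4 : (2 * a * Q) * (a / (c ^ 2 * ε ^ 2)) ≤ c ^ 2 * (a / (c ^ 2 * ε ^ 2)) := by gcongr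
  rw [e1, e2]
  linarith

/-- Lower bound for the probability that a centred real Gaussian variable lies in an interval. -/
theorem gaussianReal_Ioo_ge {Q : ℝ≥0} (hQ : Q ≠ 0) {s t : ℝ} (hs : 0 ≤ s) :
    ENNReal.ofReal ((t - s) * ((√(2 * Real.pi * Q))⁻¹ * Real.exp (-(t ^ 2 / (2 * Q)))))
      ≤ gaussianReal 0 Q (Ioo s t) := by
  rw [gaussianReal_apply _ hQ]
  calc _ ≤ ∫⁻ _ in Ioo s t,
        ENNReal.ofReal ((√(2 * Real.pi * Q))⁻¹ * Real.exp (-(t ^ 2 / (2 * Q)))) := by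
        rw [setLIntegral_const, Real.volume_Ioo, mul_comm, ENNReal.ofReal_mul (by positivity)]
    _ ≤ _ := by
        refine setLIntegral_mono_ae' measurableSet_Ioo (ae_of_all _ fun y hy => ?_)
        refine ENNReal.ofReal_le_ofReal ?_
        rw [gaussianPDFReal_def]
        simp only [sub_zero, neg_div]
        have hQ' : (0 : ℝ) < Q := by positivity
        gcongr
        · exact hs.trans hy.1.le
        · exact hy.2.le

/-- The lower bound of the large deviation principle for a centred Gaussian measure, around a
point of its Cameron–Martin space. -/
theorem exists_measure_smul_mem_ge (hν : ∀ φ : StrongDual ℝ F, ∫ y, φ y ∂ν = 0)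
    {φ : StrongDual ℝ F} {x : F} (hx : IsCameronMartin ν (StrongDual.toLp ν 2 φ) x) {A : Set F}
    (hA : IsOpen A) (hxA : x ∈ A) {η : ℝ} (hη : 0 < η) :
    ∃ K : ℝ, 0 < K ∧ ∀ᶠ ε in 𝓝[>] (0 : ℝ),
      ENNReal.ofReal (K * Real.exp (-((‖StrongDual.toLp ν 2 φ‖ ^ 2 / 2 + η) / ε ^ 2)))
        ≤ ν {y | ε • y ∈ A} := by
  set Q := ‖StrongDual.toLp ν 2 φ‖ ^ 2 with hQ
  obtain ⟨r, hr, hrA⟩ := Metric.isOpen_iff.1 hA x hxA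
  -- For Q > 0 this is the part of y independent of φ, with y = X y + Q⁻¹ φ(y) x. For Q = 0 the
  -- convention Q⁻¹ = 0 makes X the identity.
  let X : F →L[ℝ] F := ContinuousLinearMap.id ℝ F - (Q⁻¹ • φ).smulRight x
  have hX : ∀ y, X y = y - (Q⁻¹ * φ y) • x := fun y => by simp [X]
  obtain ⟨M, hM⟩ : ∃ M : ℕ, ν (X ⁻¹' Metric.ball 0 M) ≠ 0 := by
    by_contra! hcon
    have h1 := measure_iUnion_null hcon
    have h2 : ⋃ M : ℕ, X ⁻¹' Metric.ball 0 M = univ := by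
      rw [← preimage_iUnion, Metric.iUnion_ball_nat, preimage_univ]
    rw [h2, measure_univ] at h1
    exact one_ne_zero h1
  have hM0 : 0 < (ν (X ⁻¹' Metric.ball 0 M)).toReal := ENNReal.toReal_pos hM (measure_ne_top _ _)
  set κ := (ν (X ⁻¹' Metric.ball 0 M)).toReal with hκ
  have hκ' : ENNReal.ofReal κ = ν (X ⁻¹' Metric.ball 0 M) :=
    ENNReal.ofReal_toReal (measure_ne_top _ _)
  have hev : ∀ᶠ ε in 𝓝[>] (0 : ℝ), 0 < ε ∧ ε < 1 ∧ ε * M < r / 2 := by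
    have h1 : ∀ᶠ ε in 𝓝 (0 : ℝ), ε < 1 := eventually_lt_nhds one_pos
    have h2 : ∀ᶠ ε in 𝓝 (0 : ℝ), ε * M < r / 2 := by
      have : Tendsto (fun ε : ℝ => ε * M) (𝓝 0) (𝓝 (0 * M)) := tendsto_id.mul_const _
      exact this.eventually (eventually_lt_nhds (by simpa using hr))
    filter_upwards [self_mem_nhdsWithin, nhdsWithin_le_nhds h1, nhdsWithin_le_nhds h2]
      with ε a b c using ⟨a, b, c⟩
  rcases (show 0 ≤ Q by positivity).eq_or_lt with hQ0 | hQ0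
  · have hx0 : x = 0 := by
      refine (SeparatingDual.eq_zero_iff_forall_dual_eq_zero (R := ℝ) x).2 fun ψ => ?_
      have : StrongDual.toLp ν 2 φ = 0 := by
        rw [← norm_eq_zero]
        exact pow_eq_zero_iff two_ne_zero |>.1 hQ0.symm
      rw [hx.apply_eq_inner, this, inner_zero_left]
    refine ⟨κ, hM0, ?_⟩
    filter_upwards [hev] with ε hε
    refine le_trans (ENNReal.ofReal_le_ofReal ?_) (hκ'.le.trans (measure_mono fun y hy => hrA ?_))
    · refine mul_le_of_le_one_right hM0.le (Real.exp_le_one_iff.2 ?_)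
      rw [Left.neg_nonpos_iff]
      positivity
    · have hy' : ‖y‖ < M := by
        have := hy
        rw [mem_preimage, hX, hx0, smul_zero, sub_zero] at this
        simpa using this
      rw [hx0, mem_ball_zero_iff, norm_smul, Real.norm_of_nonneg hε.1.le]
      have := mul_lt_mul_of_pos_left hy' hε.1
      linarith [hε.2.2]
  -- ζ is the relative width of the window for φ(y): small enough to cost at most η in the exponent
  -- and to move the point by less than r/2 along x.
  · obtain ⟨ζ, hζ0, hζ1, hζ2⟩ : ∃ ζ : ℝ, 0 < ζ ∧ Q * (1 + ζ) ^ 2 / 2 ≤ Q / 2 + η ∧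
        ζ * ‖x‖ < r / 2 := by
      have h1 : Tendsto (fun ζ : ℝ => Q * (1 + ζ) ^ 2 / 2) (𝓝 0) (𝓝 (Q * (1 + 0) ^ 2 / 2)) :=
        (Continuous.tendsto (by fun_prop) 0)
      have h2 : Tendsto (fun ζ : ℝ => ζ * ‖x‖) (𝓝 0) (𝓝 (0 * ‖x‖)) :=
        (Continuous.tendsto (by fun_prop) 0)
      have h1' := h1.eventually (ge_mem_nhds (show Q * (1 + 0) ^ 2 / 2 < Q / 2 + η by linarith))
      have h2' := h2.eventually (eventually_lt_nhds (show 0 * ‖x‖ < r / 2 by linarith))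
      have h3 : ∀ᶠ ζ in 𝓝[>] (0 : ℝ), 0 < ζ ∧ Q * (1 + ζ) ^ 2 / 2 ≤ Q / 2 + η ∧ ζ * ‖x‖ < r / 2 := by
        filter_upwards [self_mem_nhdsWithin, nhdsWithin_le_nhds h1', nhdsWithin_le_nhds h2']
          with ζ a b c using ⟨a, b, c⟩
      exact h3.exists
    -- Jointly Gaussian, so zero covariance suffices: 𝔼[L φ] = L(x) by the Cameron–Martin property,
    -- and the correction Q⁻¹ L(x) 𝔼[φ²] equals L(x) too.
    have hind : IndepFun X φ ν := by
      have hG : HasGaussianLaw (fun y => (X y, φ y)) ν :=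
        (IsGaussian.hasGaussianLaw_id (μ := ν)).map (X.prod φ)
      refine hG.indepFun_of_covariance_strongDual fun L₁ L₂ => ?_
      have e2 : ∀ y, L₂ (φ y) = L₂ 1 * φ y := fun y => by
        have := L₂.map_smul (φ y) 1
        simpa [mul_comm] using this
      have m1 : MemLp (L₁ ∘ X) 2 ν := IsGaussian.memLp_dual ν (L₁.comp X) 2 (by simp)
      have m2 : MemLp (L₂ ∘ φ) 2 ν := IsGaussian.memLp_dual ν (L₂.comp φ) 2 (by simp)
      rw [covariance_eq_sub m1 m2]
      have i1 : ∫ y, (L₁ ∘ X) y ∂ν = 0 := hν (L₁.comp X)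
      rw [i1, zero_mul, sub_zero]
      have i2 : ∀ y, ((L₁ ∘ X) * (L₂ ∘ φ)) y
          = L₂ 1 * (L₁ y * φ y - Q⁻¹ * L₁ x * (φ y * φ y)) := by
        intro y
        simp only [Pi.mul_apply, Function.comp_apply, hX, e2, map_sub, map_smul, smul_eq_mul]
        ring
      simp only [i2]
      have hI : ∀ ψ : StrongDual ℝ F, Integrable (fun y => ψ y * φ y) ν := fun ψ =>
        (IsGaussian.memLp_dual ν ψ 2 (by simp)).integrable_mul
          (IsGaussian.memLp_dual ν φ 2 (by simp))
      rw [integral_const_mul, integral_sub (hI L₁) ((hI φ).const_mul _), integral_const_mul,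
        ← inner_dual_toLp, ← inner_dual_toLp, real_inner_self_eq_norm_sq, ← hQ, real_inner_comm,
        ← hx.apply_eq_inner]
      field_simp
      ring
    have hQn : Q.toNNReal ≠ 0 := by simpa using hQ0
    refine ⟨κ * (Q * ζ * (√(2 * Real.pi * Q))⁻¹), by positivity, ?_⟩
    filter_upwards [hev] with ε hε
    obtain ⟨hε0, hε1, hεM⟩ := hε
    have hsub : X ⁻¹' Metric.ball 0 M ∩ φ ⁻¹' Ioo (Q / ε) (Q * (1 + ζ) / ε) ⊆ {y | ε • y ∈ A} := by
      rintro y ⟨hy1, hy2⟩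
      refine hrA ?_
      have hy1' : ‖X y‖ < M := by simpa using hy1
      have e : ε • y - x = ε • X y + (ε * (Q⁻¹ * φ y) - 1) • x := by
        rw [hX, smul_sub, sub_smul, smul_smul, one_smul]
        abel
      have h1 := (div_lt_iff₀ hε0).1 hy2.1
      have h2 := (lt_div_iff₀ hε0).1 hy2.2
      have e' : ε * (Q⁻¹ * φ y) - 1 = (φ y * ε - Q) / Q := by field_simp
      have h3 : |ε * (Q⁻¹ * φ y) - 1| ≤ ζ := by
        rw [e', abs_of_nonneg (div_nonneg (by linarith) hQ0.le), div_le_iff₀ hQ0]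
        linarith
      rw [mem_ball_iff_norm, e]
      have h4 := norm_add_le (ε • X y) ((ε * (Q⁻¹ * φ y) - 1) • x)
      rw [norm_smul, norm_smul, Real.norm_of_nonneg hε0.le, Real.norm_eq_abs] at h4
      have h5 := mul_le_mul_of_nonneg_right h3 (norm_nonneg x)
      have h6 := mul_le_mul_of_nonneg_left hy1'.le hε0.le
      linarith
    refine le_trans ?_ (measure_mono hsub)
    rw [hind.measure_inter_preimage_eq_mul _ _ Metric.isOpen_ball.measurableSet measurableSet_Ioo,
      ← hκ', ← Measure.map_apply φ.measurable measurableSet_Ioo, map_dual_eq_gaussianReal hν φ,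
      mul_assoc, ENNReal.ofReal_mul hM0.le, ← hQ]
    gcongr
    refine le_trans (ENNReal.ofReal_le_ofReal ?_) (gaussianReal_Ioo_ge hQn (by positivity))
    rw [Real.coe_toNNReal _ hQ0.le, mul_assoc]
    -- The window has length Qζ/ε, and ε < 1 makes Qζ a lower bound free of ε.
    have h1 : Q * ζ ≤ Q * (1 + ζ) / ε - Q / ε := by
      rw [← sub_div, le_div_iff₀ hε0]
      nlinarith [mul_pos hQ0 hζ0]
    have h2 : (Q * (1 + ζ) / ε) ^ 2 / (2 * Q) ≤ (Q / 2 + η) / ε ^ 2 := by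
      have : (Q * (1 + ζ) / ε) ^ 2 / (2 * Q) = (Q * (1 + ζ) ^ 2 / 2) / ε ^ 2 := by field_simp
      rw [this]
      gcongr
    have h3 := (mul_pos hQ0 hζ0).le.trans h1
    gcongr

end Gaussian

/-! ### Logarithmic asymptotics in the extended reals -/

section Asymptotics

theorem tendsto_sq_mul_log_exp {k : ℝ} (hk : 0 < k) (b : ℝ) :
    Tendsto (fun ε : ℝ => ((ε ^ 2 : ℝ) : EReal)
      * ENNReal.log (ENNReal.ofReal (k * Real.exp (-(b / ε ^ 2))))) (𝓝[>] 0)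
      (𝓝 ((-b : ℝ) : EReal)) := by
  have h1 : Tendsto (fun ε : ℝ => ε ^ 2 * Real.log k - b) (𝓝[>] 0) (𝓝 (-b)) := by
    have : Tendsto (fun ε : ℝ => ε ^ 2 * Real.log k - b) (𝓝 0) (𝓝 (0 ^ 2 * Real.log k - b)) :=
      Continuous.tendsto (by fun_prop) 0
    simpa using this.mono_left nhdsWithin_le_nhds
  refine ((continuous_coe_real_ereal.tendsto _).comp h1).congr' ?_
  filter_upwards [self_mem_nhdsWithin] with ε hε
  have hε : 0 < ε := hε
  rw [ENNReal.log_ofReal_of_pos (by positivity), Real.log_mul hk.ne' (Real.exp_ne_zero _),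
    Real.log_exp, ← EReal.coe_mul]
  simp only [Function.comp_apply]
  congr 1
  field_simp
  ring

theorem limsup_sq_mul_log_le {f : ℝ → ℝ≥0∞} {K : ℝ≥0∞} (hK : K ≠ ∞) {b : ℝ}
    (h : ∀ᶠ ε in 𝓝[>] (0 : ℝ), f ε ≤ K * ENNReal.ofReal (Real.exp (-(b / ε ^ 2)))) :
    limsup (fun ε : ℝ => ((ε ^ 2 : ℝ) : EReal) * ENNReal.log (f ε)) (𝓝[>] 0)
      ≤ ((-b : ℝ) : EReal) := by
  -- K may be 0; enlarging it by 1 gives a positive prefactor, which disappears in the limit anyway.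
  have hk : 0 < K.toReal + 1 := by positivity
  rw [← (tendsto_sq_mul_log_exp hk b).limsup_eq]
  refine limsup_le_limsup ?_
  filter_upwards [h] with ε hε
  refine mul_le_mul_of_nonneg_left (ENNReal.log_monotone (hε.trans ?_))
    (by exact_mod_cast sq_nonneg ε)
  rw [ENNReal.ofReal_mul hk.le]
  gcongr
  exact ENNReal.le_ofReal_iff_toReal_le hK hk.le |>.2 (by linarith)

theorem le_liminf_sq_mul_log {f : ℝ → ℝ≥0∞} {k : ℝ} (hk : 0 < k) {b : ℝ}
    (h : ∀ᶠ ε in 𝓝[>] (0 : ℝ), ENNReal.ofReal (k * Real.exp (-(b / ε ^ 2))) ≤ f ε) :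
    ((-b : ℝ) : EReal)
      ≤ liminf (fun ε : ℝ => ((ε ^ 2 : ℝ) : EReal) * ENNReal.log (f ε)) (𝓝[>] 0) := by
  rw [← (tendsto_sq_mul_log_exp hk b).liminf_eq]
  refine liminf_le_liminf ?_
  filter_upwards [h] with ε hε
  exact mul_le_mul_of_nonneg_left (ENNReal.log_monotone hε) (by exact_mod_cast sq_nonneg ε)

theorem coe_mul_coe_nnreal (q : ℝ) (r : ℝ≥0) :
    -(((1 / q : ℝ) : EReal) * ((r : ℝ≥0∞) : EReal)) = ((-(r / q) : ℝ) : EReal) := by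
  rw [show ((r : ℝ≥0∞) : EReal) = ((r : ℝ) : EReal) from rfl, ← EReal.coe_mul, ← EReal.coe_neg]
  congr 1
  ring

/-- Letting a increase to v gives the bound, also when v = ∞; `h0` is needed for v = 0, where no a
lies strictly below v. -/
theorem le_neg_inv_mul_of_forall {ℓ : EReal} {v : ℝ≥0∞} {q : ℝ} (hq : 0 < q) (h0 : ℓ ≤ 0)
    (h : ∀ a : ℝ, 0 ≤ a → ENNReal.ofReal a < v → ℓ ≤ ((-(a / q) : ℝ) : EReal)) :
    ℓ ≤ -(((1 / q : ℝ) : EReal) * (v : EReal)) := by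
  induction v with
  | top =>
    rw [EReal.coe_ennreal_top, EReal.coe_mul_top_of_pos (by positivity), EReal.neg_top, le_bot_iff,
      EReal.eq_bot_iff_forall_lt]
    intro y
    refine (h (|y| * q + q) (by positivity) ENNReal.ofReal_lt_top).trans_lt ?_
    have e : (|y| * q + q) / q = |y| + 1 := by field_simp
    rw [EReal.coe_lt_coe_iff, e]
    have := neg_abs_le y
    linarith
  | coe r =>
    rw [coe_mul_coe_nnreal]
    rcases eq_or_ne r 0 with rfl | hr
    · simpa using h0
    refine EReal.le_of_forall_lt_iff_le.1 fun z hz => ?_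
    have hz' : -(r / q) < z := EReal.coe_lt_coe_iff.1 hz
    have hr0 : (0 : ℝ) < r := by positivity
    have h1 : -(z * q) < r := by
      have : (r : ℝ) / q * q = r := by field_simp
      nlinarith
    refine (h (max 0 (-(z * q))) (le_max_left _ _) ?_).trans (EReal.coe_le_coe_iff.2 ?_)
    · rw [← ENNReal.ofReal_coe_nnreal, ENNReal.ofReal_lt_ofReal_iff hr0]
      exact max_lt hr0 h1
    · rw [neg_le, le_div_iff₀ hq, neg_mul]
      exact le_max_right _ _

theorem neg_inv_mul_le_of_forall {ℓ : EReal} {v : ℝ≥0∞} {q : ℝ} (hq : 0 < q)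
    (h : ∀ b : ℝ, v < ENNReal.ofReal b → ((-(b / q) : ℝ) : EReal) ≤ ℓ) :
    -(((1 / q : ℝ) : EReal) * (v : EReal)) ≤ ℓ := by
  induction v with
  | top =>
    rw [EReal.coe_ennreal_top, EReal.coe_mul_top_of_pos (by positivity), EReal.neg_top]
    exact bot_le
  | coe r =>
    rw [coe_mul_coe_nnreal]
    refine EReal.ge_of_forall_gt_iff_ge.1 fun z hz => ?_
    have hz' : z < -(r / q) := EReal.coe_lt_coe_iff.1 hz
    have h1 : (r : ℝ) < -(z * q) := by
      have : (r : ℝ) / q * q = r := by field_simp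
      nlinarith
    have h2 := h (-(z * q)) (by
      rw [← ENNReal.ofReal_coe_nnreal]
      exact (ENNReal.ofReal_lt_ofReal_iff (lt_of_le_of_lt r.2 h1)).2 h1)
    have e : -(-(z * q) / q) = z := by field_simp
    rwa [e] at h2

end Asymptotics

/-! ### Contraction principle for capacities -/

section Contraction

variable {E F X : Type*} [NormedAddCommGroup E] [NormedSpace ℝ E] [MeasurableSpace E]
  [TopologicalSpace X]

theorem cap_mono (P : Measure E) (q : ℝ) (N : ℕ) {A A' : Set E} (h : A ⊆ A') :
    cap P q N A ≤ cap P q N A' :=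
  le_iInf fun O => le_iInf fun hO => le_iInf fun hA => iInf₂_le_of_le O hO
    (iInf_le_of_le (h.trans hA) le_rfl)

/-- The push-forward of a rate function with compact level sets has compact level sets. -/
theorem isCompact_iInf_fiber_le [TopologicalSpace F] [T2Space X] {Φ : F → X} (hΦ : Continuous Φ)
    {J : F → ℝ≥0∞} (hJ : ∀ β : ℝ≥0, IsCompact {x | J x ≤ β}) (α : ℝ≥0) :
    IsCompact {y | ⨅ (x : F) (_ : Φ x = y), J x ≤ α} := by
  have h : {y | ⨅ (x : F) (_ : Φ x = y), J x ≤ α}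
      -- The infimum over a fibre is not known to be attained at this point, so the level α is
      -- approached from above.
      = ⋂ n : ℕ, Φ '' {x | J x ≤ (α + 1 / (n + 1) : ℝ≥0)} := by
    ext y
    simp only [mem_ofPred_eq, mem_iInter]
    constructor
    · intro hy n
      have hlt : (α : ℝ≥0∞) < (α + 1 / (n + 1) : ℝ≥0) := by
        exact_mod_cast lt_add_of_pos_right α (by positivity)
      obtain ⟨x, hx⟩ := iInf_lt_iff.1 (hy.trans_lt hlt)
      obtain ⟨hxy, hx⟩ := iInf_lt_iff.1 hx
      exact ⟨x, hx.le, hxy⟩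
    · intro hy
      have hlim : Tendsto (fun n : ℕ => ((α + 1 / (n + 1) : ℝ≥0) : ℝ≥0∞)) atTop
          (𝓝 ((α + 0 : ℝ≥0) : ℝ≥0∞)) :=
        (ENNReal.continuous_coe.tendsto _).comp
          (tendsto_const_nhds.add tendsto_one_div_add_atTop_nhds_zero_nat)
      rw [add_zero] at hlim
      refine ge_of_tendsto' hlim fun n => ?_
      obtain ⟨x, hx, rfl⟩ := hy n
      exact iInf₂_le_of_le x rfl hx
  rw [h]
  have hc : ∀ n : ℕ, IsCompact (Φ '' {x | J x ≤ (α + 1 / (n + 1) : ℝ≥0)}) := fun n =>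
    (hJ _).image hΦ
  exact (hc 0).of_isClosed_subset (isClosed_iInter fun n => (hc n).isClosed) (iInter_subset _ 0)

theorem lowerSemicontinuous_of_isCompact_le [T2Space X] {J : X → ℝ≥0∞}
    (h : ∀ α : ℝ≥0, IsCompact {y | J y ≤ α}) : LowerSemicontinuous J := by
  refine lowerSemicontinuous_iff_isClosed_preimage.2 fun y => ?_
  induction y with
  | top => simp
  | coe α => exact (h α).isClosed

variable [OpensMeasurableSpace E]
  [NormedAddCommGroup F] [NormedSpace ℝ F] [MeasurableSpace F] [BorelSpace F]
  {P : Measure E} {L : E →L[ℝ] F} {q : ℝ}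

theorem isFiniteMeasure_of_isGaussian_map (hG : IsGaussian (P.map L)) : IsFiniteMeasure P := by
  refine ⟨?_⟩
  have h : P.map L univ = 1 := measure_univ
  rw [Measure.map_apply L.measurable MeasurableSet.univ, preimage_univ] at h
  rw [h]
  exact ENNReal.one_lt_top

theorem memLp_comp_of_isGaussian_map [IsGaussian (P.map L)] (ψ : StrongDual ℝ F) :
    MemLp (ψ.comp L) 2 P :=
  (memLp_map_measure_iff ψ.continuous.aestronglyMeasurable L.measurable.aemeasurable).1
    (IsGaussian.memLp_dual (P.map L) ψ 2 (by simp))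

variable [IsGaussian (P.map L)]

/-- Exponential upper bound for the capacity of a family of events lying in finitely many
half-spaces with a uniform margin. -/
theorem exists_cap_le_of_halfSpaces (hq : 1 < q) (N : ℕ)
    (s : Finset (StrongDual ℝ F × ℝ)) {b : ℝ}
    (hs : ∀ p ∈ s, ∀ ε : ℝ, 0 < ε →
      P.map L {y | p.2 ≤ ε * p.1 y} ≤ ENNReal.ofReal (Real.exp (-(b / ε ^ 2))))
    {A : ℝ → Set E}
    (hA : ∀ ε, 0 < ε → ∀ w ∈ A ε, ∃ p ∈ s, p.2 + 1 < ε * p.1 (L w)) :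
    limsup (fun ε : ℝ => ((ε ^ 2 : ℝ) : EReal) * ENNReal.log (cap P q N (A ε))) (𝓝[>] 0)
      ≤ ((-(b / q) : ℝ) : EReal) := by
  have hq0 : 0 < q := by linarith
  have := isFiniteMeasure_of_isGaussian_map (P := P) (L := L) inferInstance
  -- R bounds the L² norms of all the functionals, and of their multiples by ε < 1, uniformly in ε.
  set R : ℝ≥0 := 1 + ∑ p ∈ s, (eLpNorm (p.1.comp L) 2 P).toNNReal with hR
  have hpR : ∀ p ∈ s, eLpNorm (p.1.comp L) 2 P ≤ R := by
    intro p hp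
    rw [← ENNReal.coe_toNNReal (memLp_comp_of_isGaussian_map (P := P) p.1).eLpNorm_ne_top]
    exact_mod_cast (Finset.single_le_sum (f := fun p : StrongDual ℝ F × ℝ =>
      (eLpNorm (p.1.comp L) 2 P).toNNReal) (fun _ _ => zero_le) hp).trans le_add_self
  obtain ⟨K, hK, hcap⟩ := exists_cap_halfSpaces_le P hq N s (R := R) (by simp [hR])
  have hK' : K * (s.card : ℝ≥0∞) ^ (1 / q) ≠ ∞ :=
    ENNReal.mul_ne_top hK (ENNReal.rpow_ne_top_of_nonneg (by positivity) (by simp))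
  refine limsup_sq_mul_log_le hK' ?_
  have hev : ∀ᶠ ε in 𝓝[>] (0 : ℝ), 0 < ε ∧ ε < 1 := by
    filter_upwards [self_mem_nhdsWithin, nhdsWithin_le_nhds (eventually_lt_nhds one_pos)]
      with ε h1 h2 using ⟨h1, h2⟩
  filter_upwards [hev] with ε ⟨hε0, hε1⟩
  have h1 : A ε ⊆ {w | ∃ p : s, p.1.2 + 1 < (ε • p.1.1.comp L) w} := by
    intro w hw
    obtain ⟨p, hp, h⟩ := hA ε hε0 w hw
    exact ⟨⟨p, hp⟩, h⟩
  have h2 := hcap (fun p : s => ε • p.1.1.comp L) (fun p => p.1.2)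
    (fun p => (memLp_comp_of_isGaussian_map (P := P) p.1.1).const_smul ε) (fun p => by
      refine (eLpNorm_const_smul_le (c := ε) (f := p.1.1.comp L)).trans ?_
      refine le_trans (mul_le_of_le_one_left' ?_) (hpR p.1 p.2)
      rw [← ofReal_norm, Real.norm_of_nonneg hε0.le, ENNReal.ofReal_le_one]
      exact hε1.le)
  have h3 : P {w | ∃ p : s, p.1.2 ≤ (ε • p.1.1.comp L) w}
      ≤ s.card * ENNReal.ofReal (Real.exp (-(b / ε ^ 2))) := by
    have e : {w | ∃ p : s, p.1.2 ≤ (ε • p.1.1.comp L) w}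
        = ⋃ p : s, L ⁻¹' {y | p.1.2 ≤ ε * p.1.1 y} := by
      ext w
      simp
    rw [e]
    refine (measure_iUnion_fintype_le P _).trans ?_
    refine (Finset.sum_le_sum fun p _ => ?_).trans_eq (?_ :
      ∑ _p : s, ENNReal.ofReal (Real.exp (-(b / ε ^ 2))) = _)
    · rw [← Measure.map_apply L.measurable
        (isClosed_le continuous_const (by fun_prop)).measurableSet]
      exact hs p.1 p.2 ε hε0
    · simp
  calc cap P q N (A ε) ≤ K * (s.card * ENNReal.ofReal (Real.exp (-(b / ε ^ 2)))) ^ (1 / q) :=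
        (cap_mono P q N h1).trans (h2.trans (by gcongr))
    _ = _ := by
        rw [ENNReal.mul_rpow_of_nonneg _ _ (by positivity), ← mul_assoc,
          ENNReal.ofReal_rpow_of_pos (Real.exp_pos _), ← Real.exp_mul]
        congr 4
        field_simp

variable [FiniteDimensional ℝ F] [SecondCountableTopology F]

/-- The capacity large deviation principle for the image, under a continuous map, of a small
multiple of a Gaussian random variable with values in a finite-dimensional space. -/
theorem capLDP_of_isGaussian_map [T2Space X] (hq : 1 < q) (N : ℕ)
    (hcent : ∀ φ : StrongDual ℝ F, ∫ y, φ y ∂(P.map L) = 0) {Φ : F → X} (hΦ : Continuous Φ)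
    {T : ℝ → E → X} (hT : ∀ ε w, T ε w = Φ (ε • L w)) :
    CapLDP P q N T fun y => ⨅ (x : F) (_ : Φ x = y), gaussianRate (P.map L) x := by
  have hq0 : 0 < q := by linarith
  have hlevel := isCompact_iInf_fiber_le hΦ (J := gaussianRate (P.map L)) fun β => by
    have := isCompact_gaussianRate_le (ν := P.map L) β.2
    rwa [show ENNReal.ofReal β.1 = β from ENNReal.ofReal_coe_nnreal] at this
  refine ⟨lowerSemicontinuous_of_isCompact_le hlevel, fun α _ => hlevel α, fun C hC => ?_,
    fun G hG => ?_⟩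
  · refine le_neg_inv_mul_of_forall hq0 ?_ fun a ha hav => ?_
    -- The trivial bound by 0 comes from the degenerate half-space with ψ = 0 and c = −2: it
    -- contains every point because −2 + 1 < 0.
    · have := exists_cap_le_of_halfSpaces (P := P) (L := L) hq N {(0, -2)} (b := 0)
        (fun p _ ε _ => by simpa using prob_le_one)
        (A := fun ε => {w | T ε w ∈ C}) (fun ε _ w _ => ⟨_, Finset.mem_singleton_self _, by simp⟩)
      simpa using this
    · obtain ⟨s, hs, hsA⟩ := exists_finset_halfSpaces (ν := P.map L) (hC.preimage hΦ) ha
        (fun x hx => hav.trans_le (iInf₂_le_of_le (Φ x) hx (iInf₂_le_of_le x rfl le_rfl)))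
      refine exists_cap_le_of_halfSpaces (P := P) (L := L) hq N s
        (fun p hp ε hε => measure_halfSpace_le hcent ha (hs p hp).1 (hs p hp).2 hε) ?_
      intro ε _ w hw
      have hw' : ε • L w ∈ Φ ⁻¹' C := by
        have : T ε w ∈ C := hw
        rwa [hT] at this
      simpa using hsA _ hw'
  · refine neg_inv_mul_le_of_forall hq0 fun b hb => ?_
    simp only [iInf_lt_iff] at hb
    obtain ⟨y, hy, x, rfl, hb⟩ := hb
    obtain ⟨Z, hb⟩ := iInf_lt_iff.1 hb
    obtain ⟨hZ, hb⟩ := iInf_lt_iff.1 hb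
    have hb' : ‖Z‖ ^ 2 / 2 < b := ENNReal.ofReal_lt_ofReal_iff'.1 hb |>.1
    obtain ⟨φ, rfl⟩ : ∃ φ : StrongDual ℝ F, StrongDual.toLp (P.map L) 2 φ = Z := by
      have := hZ.1
      rw [firstChaos_eq_range] at this
      exact this
    -- With η = b − ‖Z‖²/2 the exponent is exactly b.
    obtain ⟨k, hk, hev⟩ := exists_measure_smul_mem_ge hcent hZ (hG.preimage hΦ) hy (sub_pos.2 hb')
    refine le_liminf_sq_mul_log (Real.rpow_pos_of_pos hk (1 / q)) ?_
    filter_upwards [hev] with ε hε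
    rw [add_sub_cancel] at hε
    have e : P.map L {y | ε • y ∈ Φ ⁻¹' G} = P {w | T ε w ∈ G} := by
      have hm : MeasurableSet {y : F | ε • y ∈ Φ ⁻¹' G} :=
        ((hG.preimage hΦ).preimage (continuous_const_smul ε)).measurableSet
      rw [Measure.map_apply L.measurable hm]
      congr 1
      ext w
      simp [hT]
    rw [e] at hε
    refine le_trans ?_ (measure_rpow_le_cap hq N _)
    refine le_trans (le_of_eq ?_) (ENNReal.rpow_le_rpow hε (by positivity : (0 : ℝ) ≤ 1 / q))
    rw [ENNReal.ofReal_rpow_of_pos (by positivity), Real.mul_rpow hk.le (Real.exp_pos _).le,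
      ← Real.exp_mul]
    congr 3
    field_simp

end Contraction

/-! ### Riemann–Stieltjes integrals of Lipschitz functions -/

section RiemannStieltjes

variable {f f' g g' : I → ℝ} {s t u : I} {A M : ℝ}

theorem Partition.le_last (D : Partition s t) (j : Fin (D.n + 1)) : D.pts j ≤ t := by
  simpa only [D.last] using D.strictMono.monotone (Fin.le_last j)

theorem Partition.castSucc_le_succ (D : Partition s t) (l : Fin D.n) :
    D.pts l.castSucc ≤ D.pts l.succ :=
  D.strictMono.monotone l.castSucc_lt_succ.le

theorem Partition.sum_sub (D : Partition s t) (φ : I → ℝ) :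
    ∑ l : Fin D.n, (φ (D.pts l.succ) - φ (D.pts l.castSucc)) = φ t - φ s := by
  set a : ℕ → ℝ := fun k => φ (D.pts ⟨min k D.n, by omega⟩) with ha
  have h1 : ∀ l : Fin D.n, φ (D.pts l.succ) - φ (D.pts l.castSucc) = a (l + 1) - a l := by
    intro l
    have e1 : (⟨min (l + 1 : ℕ) D.n, by omega⟩ : Fin (D.n + 1)) = l.succ := by
      ext
      simp only [Fin.val_succ]
      omega
    have e2 : (⟨min (l : ℕ) D.n, by omega⟩ : Fin (D.n + 1)) = l.castSucc := by
      ext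
      simp only [Fin.val_castSucc]
      omega
    simp only [ha, e1, e2]
  rw [Finset.sum_congr rfl fun l _ => h1 l, ← Finset.sum_range fun k => a (k + 1) - a k,
    Finset.sum_range_sub]
  have e1 : (⟨min D.n D.n, by omega⟩ : Fin (D.n + 1)) = Fin.last D.n := by
    ext
    simp
  have e2 : (⟨min 0 D.n, by omega⟩ : Fin (D.n + 1)) = 0 := by
    ext
    simp
  simp only [ha, e1, e2, D.first, D.last]

/-- A bound for the difference of two Riemann–Stieltjes integrals. -/
theorem HasRSIntegral.abs_sub_le {J J' B K : ℝ} (hst : s ≤ t)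
    (h : HasRSIntegral f g s t J) (h' : HasRSIntegral f' g' s t J')
    (hB : ∀ a, s ≤ a → a ≤ t → |f a - f' a| ≤ B) (hM : ∀ a b, |g a - g b| ≤ M * |(a : ℝ) - b|)
    (hA : ∀ a, s ≤ a → a ≤ t → |f' a| ≤ A)
    (hK : ∀ a b, |(g a - g' a) - (g b - g' b)| ≤ K * |(a : ℝ) - b|) :
    |J - J'| ≤ (B * M + A * K) * ((t : ℝ) - s) := by
  refine le_of_forall_pos_le_add fun η hη => ?_
  obtain ⟨δ₁, h₁, H₁⟩ := h (η / 2) (by positivity)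
  obtain ⟨δ₂, h₂, H₂⟩ := h' (η / 2) (by positivity)
  obtain ⟨D, hD⟩ := exists_partition hst (lt_min h₁ h₂)
  have htag : ∀ l : Fin D.n, D.pts l.castSucc ≤ D.pts l.castSucc ∧ D.pts l.castSucc ≤ D.pts l.succ :=
    fun l => ⟨le_rfl, D.castSucc_le_succ l⟩
  have a := H₁ D (fun l => D.pts l.castSucc) (fun l => (hD l).trans_le (min_le_left _ _)) htag
  have b := H₂ D (fun l => D.pts l.castSucc) (fun l => (hD l).trans_le (min_le_right _ _)) htag
  have c : |∑ l : Fin D.n, f (D.pts l.castSucc) * (g (D.pts l.succ) - g (D.pts l.castSucc))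
      - ∑ l : Fin D.n, f' (D.pts l.castSucc) * (g' (D.pts l.succ) - g' (D.pts l.castSucc))|
      ≤ (B * M + A * K) * ((t : ℝ) - s) := by
    rw [← D.sum_sub fun a => (a : ℝ), Finset.mul_sum, ← Finset.sum_sub_distrib]
    refine (Finset.abs_sum_le_sum_abs _ _).trans (Finset.sum_le_sum fun l _ => ?_)
    have hl := D.castSucc_le_succ l
    have hl' : 0 ≤ (D.pts l.succ : ℝ) - D.pts l.castSucc := sub_nonneg.2 hl
    have e1 := hB _ (D.first_le l.castSucc) (D.le_last _)
    have e2 := hM (D.pts l.succ) (D.pts l.castSucc)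
    have e3 := hA _ (D.first_le l.castSucc) (D.le_last _)
    have e4 := hK (D.pts l.succ) (D.pts l.castSucc)
    rw [abs_of_nonneg hl'] at e2 e4
    set p := D.pts l.castSucc
    set r := D.pts l.succ
    -- Separates the change of integrand (size B, against g) from the change of integrator (size K,
    -- against f').
    have e5 : f p * (g r - g p) - f' p * (g' r - g' p)
        = (f p - f' p) * (g r - g p) + f' p * ((g r - g' r) - (g p - g' p)) := by ring
    rw [e5]
    refine (abs_add_le _ _).trans ?_
    rw [abs_mul, abs_mul, add_mul, mul_assoc, mul_assoc]
    exact add_le_add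
      (mul_le_mul e1 e2 (abs_nonneg _) ((abs_nonneg _).trans e1))
      (mul_le_mul e3 e4 (abs_nonneg _) ((abs_nonneg _).trans e3))
  rw [abs_lt] at a b
  rw [abs_le] at c ⊢
  constructor <;> linarith [a.1, a.2, b.1, b.2, c.1, c.2]

theorem hasRSIntegral_zero (g : I → ℝ) (s t : I) : HasRSIntegral (fun _ => 0) g s t 0 :=
  fun η hη => ⟨1, one_pos, fun D ξ _ _ => by simpa using hη⟩

theorem HasRSIntegral.abs_le {J : ℝ} (hst : s ≤ t) (h : HasRSIntegral f g s t J)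
    (hA : ∀ a, s ≤ a → a ≤ t → |f a| ≤ A) (hM : ∀ a b, |g a - g b| ≤ M * |(a : ℝ) - b|) :
    |J| ≤ A * M * ((t : ℝ) - s) := by
  have := h.abs_sub_le hst (hasRSIntegral_zero g s t) (B := A) (A := 0) (K := 0)
    (fun a ha hb => by simpa using hA a ha hb) hM (by simp) (by simp)
  simpa using this

/-- The Riemann–Stieltjes integral of a Lipschitz function against a Lipschitz function exists and
is additive. -/
theorem exists_hasRSIntegral (hA0 : 0 ≤ A)
    (hf : ∀ a b, s ≤ a → s ≤ b → |f a - f b| ≤ A * |(a : ℝ) - b|) {M : ℝ≥0}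
    (hg : ∀ a b, |g a - g b| ≤ M * |(a : ℝ) - b|) :
    ∃ J : I → ℝ, (∀ t, s ≤ t → HasRSIntegral f g s t (J t)) ∧
      ∀ t u, s ≤ t → t ≤ u → HasRSIntegral f g t u (J u - J t) := by
  -- Clamping extends g to a Lipschitz function on ℝ, hence an absolutely continuous one, and the
  -- integral becomes the Lebesgue integral of f G'.
  set G : ℝ → ℝ := fun r => g (projIcc 0 1 zero_le_one r) with hG
  have hGg : ∀ a : I, G a = g a := fun a => by rw [hG]; simp only [projIcc_val]
  have hproj : ∀ a b : ℝ, |(projIcc (0 : ℝ) 1 zero_le_one a : ℝ) - projIcc (0 : ℝ) 1 zero_le_one b|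
      ≤ |a - b| := fun a b => by
    exact (LipschitzWith.projIcc (zero_le_one (α := ℝ))).dist_le_mul a b |>.trans_eq
      (by simp [Real.dist_eq])
  have hGL : LipschitzWith M G := LipschitzWith.of_dist_le_mul fun a b => by
    rw [Real.dist_eq, Real.dist_eq]
    exact (hg _ _).trans (mul_le_mul_of_nonneg_left (hproj a b) M.2)
  have hGac : ∀ a b : ℝ, AbsolutelyContinuousOnInterval G a b := fun a b =>
    (hGL.lipschitzOnWith).absolutelyContinuousOnInterval
  set φ : ℝ → ℝ := fun r => f (projIcc 0 1 zero_le_one r) with hφ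
  have hφc : ∀ a b : I, s ≤ a → a ≤ b → ContinuousOn φ (uIcc (a : ℝ) b) := by
    intro a b hsa hab
    have hab' : (a : ℝ) ≤ b := hab
    rw [uIcc_of_le hab']
    have hs : ∀ r ∈ Icc (a : ℝ) b, s ≤ projIcc 0 1 zero_le_one r := fun r hr => by
      have : projIcc (0 : ℝ) 1 zero_le_one (a : ℝ) ≤ projIcc 0 1 zero_le_one r :=
        monotone_projIcc _ hr.1
      rw [projIcc_val] at this
      exact hsa.trans this
    refine (LipschitzOnWith.of_dist_le_mul (K := ⟨A, hA0⟩) fun r hr r' hr' => ?_).continuousOn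
    rw [Real.dist_eq, Real.dist_eq]
    exact (hf _ _ (hs r hr) (hs r' hr')).trans (mul_le_mul_of_nonneg_left (hproj r r') hA0)
  have hint : ∀ a b : I, s ≤ a → a ≤ b →
      IntervalIntegrable (fun r => φ r * deriv G r) volume (a : ℝ) b := fun a b hsa hab =>
    ((hGac a b).intervalIntegrable_deriv).continuousOn_mul (hφc a b hsa hab)
  set J : I → ℝ := fun t => ∫ r in (s : ℝ)..t, φ r * deriv G r with hJ
  have hJsub : ∀ a b : I, s ≤ a → a ≤ b → J b - J a = ∫ r in (a : ℝ)..b, φ r * deriv G r :=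
    fun a b hsa hab => intervalIntegral.integral_interval_sub_left
      (hint s b le_rfl (hsa.trans hab)) (hint s a le_rfl hsa)
  have key : ∀ t u, s ≤ t → t ≤ u → HasRSIntegral f g t u (J u - J t) := by
    intro t u hst htu η hη
    -- On a cell of length below δ the integrand varies by at most Aδ, so the total error is at most
    -- AδM, which is below η.
    refine ⟨η / (A * M + 1), by positivity, fun D ξ hm hξ => ?_⟩
    set δ := η / (A * M + 1) with hδ
    have hδ0 : 0 < δ := by positivity
    rw [← D.sum_sub J, ← Finset.sum_sub_distrib]
    have hterm : ∀ l : Fin D.n, |f (ξ l) * (g (D.pts l.succ) - g (D.pts l.castSucc))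
        - (J (D.pts l.succ) - J (D.pts l.castSucc))|
        ≤ A * δ * M * ((D.pts l.succ : ℝ) - D.pts l.castSucc) := by
      intro l
      have hl := D.castSucc_le_succ l
      have hl' : (D.pts l.castSucc : ℝ) ≤ D.pts l.succ := hl
      have hml := hm l
      have hsl : s ≤ D.pts l.castSucc := hst.trans (D.first_le _)
      have hξl := hξ l
      set p := D.pts l.castSucc
      set r := D.pts l.succ
      rw [hJsub p r hsl hl, ← hGg, ← hGg, ← (hGac p r).integral_deriv_eq_sub,
        ← intervalIntegral.integral_const_mul, ← intervalIntegral.integral_sub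
          ((hGac p r).intervalIntegrable_deriv.const_mul _) (hint p r hsl hl)]
      rw [← abs_of_nonneg (sub_nonneg.2 hl'), ← Real.norm_eq_abs]
      refine intervalIntegral.norm_integral_le_of_norm_le_const (E := ℝ) fun y hy => ?_
      rw [uIoc_of_le hl'] at hy
      rw [← sub_mul, norm_mul]
      have hyI : y ∈ I := ⟨p.2.1.trans hy.1.le, hy.2.trans r.2.2⟩
      have hpy : p ≤ ⟨y, hyI⟩ := hy.1.le
      have h1 : |f (ξ l) - φ y| ≤ A * δ := by
        simp only [hφ]
        rw [projIcc_of_mem _ hyI]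
        refine (hf _ _ (hsl.trans hξl.1) (hsl.trans hpy)).trans ?_
        refine mul_le_mul_of_nonneg_left ?_ hA0
        have a1 : (p : ℝ) ≤ ξ l := hξl.1
        have a2 : (ξ l : ℝ) ≤ r := hξl.2
        rw [_root_.abs_le]
        constructor <;> linarith [hy.1, hy.2]
      exact mul_le_mul h1 (norm_deriv_le_of_lipschitz hGL) (norm_nonneg _) (by positivity)
    refine (Finset.abs_sum_le_sum_abs _ _).trans_lt ((Finset.sum_le_sum fun l _ =>
      hterm l).trans_lt ?_)
    rw [← Finset.mul_sum, D.sum_sub fun a => (a : ℝ)]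
    have h1 : (u : ℝ) - t ≤ 1 := by linarith [u.2.2, t.2.1]
    have h2 : δ * (A * M + 1) = η := by
      rw [hδ]
      field_simp
    have h3 : A * δ * M * ((u : ℝ) - t) ≤ A * δ * M * 1 := by
      have := M.2
      gcongr
    linarith
  refine ⟨J, fun t hst => ?_, key⟩
  have := key s t le_rfl hst
  simpa [hJ] using this

end RiemannStieltjes

/-! ### Iterated integrals and p-variation of Lipschitz paths -/

section Lifts

variable {d : ℕ}

/-- The iterated integrals of a Lipschitz path exist, are bounded and are Lipschitz. -/
theorem iteratedIntegral_lipschitz {w : I → Rd d} {M : ℝ≥0}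
    (hw : ∀ i a b, |w a i - w b i| ≤ M * |(a : ℝ) - b|) (k : ℕ) : ∀ (j : Fin k → Fin d) (s : I),
      (∀ t, s ≤ t → |iteratedIntegral w k j s t| ≤ M ^ k) ∧
      ∀ t u, s ≤ t → s ≤ u →
        |iteratedIntegral w k j s t - iteratedIntegral w k j s u| ≤ M ^ k * |(t : ℝ) - u| := by
  induction k with
  | zero => intro j s; simp [iteratedIntegral]
  | succ k ih =>
    intro j s
    obtain ⟨J, hJ, hJ'⟩ := exists_hasRSIntegral (pow_nonneg M.2 k) (ih (Fin.init j) s).2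
      (hw (j (Fin.last k)))
    have hval : ∀ t, s ≤ t → iteratedIntegral w (k + 1) j s t = J t := fun t hst =>
      rsIntegral_eq hst (hJ t hst)
    have hle : ∀ t u, s ≤ t → t ≤ u → |J u - J t| ≤ M ^ (k + 1) * ((u : ℝ) - t) := by
      intro t u hst htu
      rw [pow_succ]
      exact (hJ' t u hst htu).abs_le htu (fun a ha _ => (ih (Fin.init j) s).1 a (hst.trans ha))
        (hw _)
    refine ⟨fun t hst => ?_, fun t u hst hsu => ?_⟩
    · rw [hval t hst]
      have h1 := (hJ t hst).abs_le hst (fun a ha _ => (ih (Fin.init j) s).1 a ha) (hw _)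
      refine h1.trans ?_
      rw [← pow_succ]
      refine mul_le_of_le_one_right (pow_nonneg M.2 _) ?_
      linarith [t.2.2, s.2.1]
    · rw [hval t hst, hval u hsu]
      rcases le_total t u with h | h
      · rw [abs_sub_comm, abs_sub_comm (t : ℝ), abs_of_nonneg (sub_nonneg.2 (show (t : ℝ) ≤ u from h))]
        exact hle t u hst h
      · rw [abs_of_nonneg (sub_nonneg.2 (show (u : ℝ) ≤ t from h))]
        exact hle u t hsu h

/-- For Lipschitz paths `rsIntegral` never falls back on its default value 0. -/
theorem hasRSIntegral_iteratedIntegral {w : I → Rd d} {M : ℝ≥0}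
    (hw : ∀ i a b, |w a i - w b i| ≤ M * |(a : ℝ) - b|) {k : ℕ} (j : Fin (k + 1) → Fin d) {s t : I}
    (hst : s ≤ t) : HasRSIntegral (fun u => iteratedIntegral w k (Fin.init j) s u)
      (fun u => w u (j (Fin.last k))) s t (iteratedIntegral w (k + 1) j s t) := by
  obtain ⟨J, hJ, -⟩ := exists_hasRSIntegral (pow_nonneg M.2 k)
    (iteratedIntegral_lipschitz hw k (Fin.init j) s).2 (hw (j (Fin.last k)))
  have : iteratedIntegral w (k + 1) j s t = J t := rsIntegral_eq hst (hJ t hst)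
  rw [this]
  exact hJ t hst

/-- The iterated integrals depend on the path in a locally Lipschitz way. -/
theorem abs_iteratedIntegral_sub_le {w w' : I → Rd d} {M : ℝ≥0} {η : ℝ}
    (hw : ∀ i a b, |w a i - w b i| ≤ M * |(a : ℝ) - b|)
    (hw' : ∀ i a b, |w' a i - w' b i| ≤ M * |(a : ℝ) - b|) (hη : 0 ≤ η)
    (hww' : ∀ i a b, |(w a i - w' a i) - (w b i - w' b i)| ≤ η * |(a : ℝ) - b|) (k : ℕ) :
    ∀ (j : Fin k → Fin d) (s t : I), s ≤ t →
      |iteratedIntegral w k j s t - iteratedIntegral w' k j s t|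
        ≤ k * M ^ (k - 1) * η * ((t : ℝ) - s) := by
  induction k with
  | zero => intro j s t _; simp [iteratedIntegral]
  | succ k ih =>
    intro j s t hst
    have h := (hasRSIntegral_iteratedIntegral hw j hst).abs_sub_le hst
      (hasRSIntegral_iteratedIntegral hw' j hst) (B := k * M ^ (k - 1) * η) (A := M ^ k)
      (fun a ha _ => (ih (Fin.init j) s a ha).trans
        (mul_le_of_le_one_right (by positivity) (by linarith [a.2.2, s.2.1])))
      (hw _) (fun a ha _ => (iteratedIntegral_lipschitz hw' k (Fin.init j) s).1 a ha) (hww' _)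
    refine h.trans_eq ?_
    -- The exponent k − 1 is truncated at k = 0, where the factor k vanishes anyway.
    rcases k with _ | k
    · simp
    · simp only [Nat.add_sub_cancel]
      push_cast
      ring

/-- At level i the increments differ by at most c δ over a cell of length δ ≤ 1. Since p/i ≥ 1, (c
δ)^{p/i} ≤ c^{p/i} δ, and the lengths add up to 1. The sum over levels dominates their maximum. -/
theorem pVarDist_pathLift_le {p : ℝ} {w w' : I → Rd d} {M : ℝ≥0} {η : ℝ}
    (hw : ∀ i a b, |w a i - w b i| ≤ M * |(a : ℝ) - b|)
    (hw' : ∀ i a b, |w' a i - w' b i| ≤ M * |(a : ℝ) - b|) (hη : 0 ≤ η)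
    (hww' : ∀ i a b, |(w a i - w' a i) - (w b i - w' b i)| ≤ η * |(a : ℝ) - b|) :
    pVarDist p (pathLift ⌊p⌋₊ w) (pathLift ⌊p⌋₊ w') ≤
      ENNReal.ofReal (∑ i ∈ Finset.range (⌊p⌋₊ + 1),
        √(Fintype.card (Fin i → Fin d)) * (i * M ^ (i - 1)) * η) := by
  refine iSup_le fun i => iSup_le fun hi => iSup_le fun D => ?_
  have hip : ((i : ℕ) : ℝ) ≤ p := (Nat.le_floor_iff' (by omega)).1 (by omega)
  have hi0 : (0 : ℝ) < ((i : ℕ) : ℝ) := by exact_mod_cast hi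
  have hp : 0 < p := lt_of_lt_of_le hi0 hip
  have h1 : 1 ≤ p / (i : ℕ) := by rwa [le_div_iff₀ hi0, one_mul]
  set c : ℝ := √(Fintype.card (Fin i → Fin d)) * (((i : ℕ) : ℝ) * M ^ ((i : ℕ) - 1)) * η with hc
  have hc0 : 0 ≤ c := by positivity
  have hterm : ∀ l : Fin D.n, edist (pathLift ⌊p⌋₊ w (D.interval l) i)
      (pathLift ⌊p⌋₊ w' (D.interval l) i)
      ≤ ENNReal.ofReal c * ENNReal.ofReal ((D.pts l.succ : ℝ) - D.pts l.castSucc) := by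
    intro l
    have hl := D.castSucc_le_succ l
    have hl' : 0 ≤ (D.pts l.succ : ℝ) - D.pts l.castSucc := sub_nonneg.2 hl
    rw [← ENNReal.ofReal_mul hc0, edist_dist]
    refine ENNReal.ofReal_le_ofReal ?_
    rw [EuclideanSpace.dist_eq]
    set δ := (D.pts l.succ : ℝ) - D.pts l.castSucc
    set b := ((i : ℕ) : ℝ) * M ^ ((i : ℕ) - 1) * η * δ with hb
    have hb0 : 0 ≤ b := by positivity
    calc _ ≤ √(∑ _j : Fin i → Fin d, b ^ 2) := by
          refine Real.sqrt_le_sqrt (Finset.sum_le_sum fun j _ => ?_)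
          refine pow_le_pow_left₀ dist_nonneg ?_ 2
          exact abs_iteratedIntegral_sub_le hw hw' hη hww' i j _ _ hl
      _ = c * δ := by
          rw [Finset.sum_const, Finset.card_univ, nsmul_eq_mul,
            Real.sqrt_mul (Nat.cast_nonneg _), Real.sqrt_sq hb0, hb, hc]
          ring
  have hsum : ∑ l : Fin D.n, edist (pathLift ⌊p⌋₊ w (D.interval l) i)
      (pathLift ⌊p⌋₊ w' (D.interval l) i) ^ (p / (i : ℕ)) ≤ ENNReal.ofReal c ^ (p / (i : ℕ)) := by
    calc _ ≤ ∑ l : Fin D.n, ENNReal.ofReal c ^ (p / (i : ℕ))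
            * ENNReal.ofReal ((D.pts l.succ : ℝ) - D.pts l.castSucc) := by
          refine Finset.sum_le_sum fun l _ => ?_
          refine (ENNReal.rpow_le_rpow (hterm l) (by positivity)).trans ?_
          rw [ENNReal.mul_rpow_of_nonneg _ _ (by positivity)]
          refine mul_le_mul_right ?_ _
          refine (ENNReal.rpow_le_rpow_of_exponent_ge ?_ h1).trans_eq (ENNReal.rpow_one _)
          rw [ENNReal.ofReal_le_one]
          linarith [(D.pts l.succ).2.2, (D.pts l.castSucc).2.1]
      _ = _ := by
          rw [← Finset.mul_sum, ← ENNReal.ofReal_sum_of_nonneg fun l _ =>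
            sub_nonneg.2 (show (D.pts l.castSucc : ℝ) ≤ D.pts l.succ from D.castSucc_le_succ l),
            D.sum_sub fun a => (a : ℝ)]
          simp
  refine (ENNReal.rpow_le_rpow hsum (by positivity)).trans ?_
  rw [← ENNReal.rpow_mul, show p / ((i : ℕ) : ℝ) * (((i : ℕ) : ℝ) / p) = 1 by field_simp,
    ENNReal.rpow_one]
  refine ENNReal.ofReal_le_ofReal ?_
  exact Finset.single_le_sum (f := fun i : ℕ => √(Fintype.card (Fin i → Fin d) : ℝ)
    * ((i : ℝ) * M ^ (i - 1)) * η) (fun _ _ => by positivity) (Finset.mem_range.2 i.2)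

end Lifts

/-! ### Continuity and scaling of the dyadic lift -/

section Dyadic

variable {d m : ℕ}

theorem node_sub (x y : Fin (2 ^ m) → Rd d) (k : ℕ) : node (x - y) k = node x k - node y k := by
  rcases k with _ | k
  · simp [node]
  · by_cases h : k < 2 ^ m <;> simp [node, h]

theorem node_smul (ε : ℝ) (x : Fin (2 ^ m) → Rd d) (k : ℕ) : node (ε • x) k = ε • node x k := by
  rcases k with _ | k
  · simp [node]
  · by_cases h : k < 2 ^ m <;> simp [node, h]

theorem norm_node_le (x : Fin (2 ^ m) → Rd d) (k : ℕ) : ‖node x k‖ ≤ ‖x‖ := by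
  rcases k with _ | k
  · simp [node]
  · by_cases h : k < 2 ^ m
    · simpa [node, h] using norm_le_pi_norm x ⟨k, h⟩
    · simp [node, h]

theorem dyadicPath_eq_sum (x : Fin (2 ^ m) → Rd d) (t : I) : (dyadicPath m x : C(I, Rd d)) t
    = ∑ k ∈ Finset.range (2 ^ m), ramp m k (t : ℝ) • (node x (k + 1) - node x k) := rfl

theorem dyadicPath_sub (x y : Fin (2 ^ m) → Rd d) (t : I) :
    (dyadicPath m (x - y) : C(I, Rd d)) t
      = (dyadicPath m x : C(I, Rd d)) t - (dyadicPath m y : C(I, Rd d)) t := by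
  simp only [dyadicPath_eq_sum, node_sub, ← Finset.sum_sub_distrib, ← smul_sub]
  refine Finset.sum_congr rfl fun k _ => ?_
  congr 1
  abel

theorem dyadicPath_smul (ε : ℝ) (x : Fin (2 ^ m) → Rd d) (t : I) :
    (dyadicPath m (ε • x) : C(I, Rd d)) t = ε • (dyadicPath m x : C(I, Rd d)) t := by
  simp only [dyadicPath_eq_sum, node_smul, Finset.smul_sum, ← smul_sub]
  exact Finset.sum_congr rfl fun k _ => smul_comm _ _ _

/-- There are 2^m ramps, each 2^m-Lipschitz, with weights of norm at most 2‖x‖. -/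
theorem abs_dyadicPath_sub_le (x : Fin (2 ^ m) → Rd d) (i : Fin d) (a b : I) :
    |(dyadicPath m x : C(I, Rd d)) a i - (dyadicPath m x : C(I, Rd d)) b i|
      ≤ 2 ^ m * (2 ^ m * 2) * ‖x‖ * |(a : ℝ) - b| := by
  have e : (dyadicPath m x : C(I, Rd d)) a i - (dyadicPath m x : C(I, Rd d)) b i
      = ((dyadicPath m x : C(I, Rd d)) a - (dyadicPath m x : C(I, Rd d)) b) i := rfl
  rw [e, ← Real.norm_eq_abs]
  refine (PiLp.norm_apply_le _ i).trans ?_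
  rw [dyadicPath_eq_sum, dyadicPath_eq_sum, ← Finset.sum_sub_distrib]
  refine (norm_sum_le _ _).trans ?_
  calc _ ≤ ∑ _k ∈ Finset.range (2 ^ m), 2 ^ m * |(a : ℝ) - b| * (2 * ‖x‖) := by
        refine Finset.sum_le_sum fun k _ => ?_
        rw [← sub_smul, norm_smul]
        refine mul_le_mul ?_ ?_ (norm_nonneg _) (by positivity)
        · have := (lipschitzWith_ramp m k).dist_le_mul (a : ℝ) b
          rw [Real.dist_eq, Real.dist_eq] at this
          exact_mod_cast this
        · refine (norm_sub_le _ _).trans ?_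
          linarith [norm_node_le x (k + 1), norm_node_le x k]
    _ = _ := by
        rw [Finset.sum_const, Finset.card_range, nsmul_eq_mul]
        push_cast
        ring

/-- Near x the interpolated paths share a Lipschitz constant, and by linearity the difference of two
of them has one proportional to ‖y − x‖. -/
theorem continuous_dyadicLift (p : ℝ) (m : ℕ) :
    Continuous (dyadicLift p m : (Fin (2 ^ m) → Rd d) → SmoothRoughPath d p) := by
  refine continuous_iff_continuousAt.2 fun x => ?_
  rw [ContinuousAt, tendsto_iff_edist_tendsto_0]
  set M : ℝ≥0 := ⟨2 ^ m * (2 ^ m * 2) * (‖x‖ + 1), by positivity⟩ with hM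
  set c : (Fin (2 ^ m) → Rd d) → ℝ := fun y => ∑ i ∈ Finset.range (⌊p⌋₊ + 1),
    √(Fintype.card (Fin i → Fin d) : ℝ) * ((i : ℝ) * M ^ (i - 1))
      * (2 ^ m * (2 ^ m * 2) * ‖y - x‖) with hc
  have hlim : Tendsto (fun y => ENNReal.ofReal (c y)) (𝓝 x) (𝓝 0) := by
    have h1 : Continuous c := by fun_prop
    have h2 : c x = 0 := by simp [hc]
    have := ENNReal.tendsto_ofReal (h1.tendsto x)
    rwa [h2, ENNReal.ofReal_zero] at this
  have hball : ∀ᶠ y in 𝓝 x, ‖y‖ ≤ ‖x‖ + 1 := by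
    filter_upwards [Metric.ball_mem_nhds x one_pos] with y hy
    have h1 : ‖y - x‖ < 1 := by simpa [dist_eq_norm] using hy
    have h2 := norm_sub_norm_le y x
    linarith
  refine tendsto_of_tendsto_of_tendsto_of_le_of_le' tendsto_const_nhds hlim
    (Eventually.of_forall fun _ => zero_le) ?_
  filter_upwards [hball] with y hy
  have hlip : ∀ z : Fin (2 ^ m) → Rd d, ‖z‖ ≤ ‖x‖ + 1 → ∀ (i : Fin d) (a b : I),
      |(dyadicPath m z : C(I, Rd d)) a i - (dyadicPath m z : C(I, Rd d)) b i|
        ≤ M * |(a : ℝ) - b| := by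
    intro z hz i a b
    refine (abs_dyadicPath_sub_le z i a b).trans (mul_le_mul_of_nonneg_right ?_ (abs_nonneg _))
    exact mul_le_mul_of_nonneg_left hz (by positivity)
  refine pVarDist_pathLift_le (hlip y hy) (hlip x (by linarith)) (by positivity) fun i a b => ?_
  have := abs_dyadicPath_sub_le (y - x) i a b
  rwa [dyadicPath_sub, dyadicPath_sub] at this

theorem continuous_Phi (p : ℝ) (m : ℕ) : Continuous (Phi (d := d) p m) :=
  (UniformSpace.Completion.continuous_coe _).comp (continuous_dyadicLift p m)

theorem dilate_dyadicLift (p : ℝ) (ε : ℝ) (x : Fin (2 ^ m) → Rd d) :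
    (dyadicLift p m x).dilate ε = dyadicLift p m (ε • x) :=
  Subtype.ext (dilate_lift _ ε _ _ (dyadicPath_smul ε x))

/-- The sampling map as a continuous linear map. -/
noncomputable def sampleCLM (d m : ℕ) : PathSpace d →L[ℝ] (Fin (2 ^ m) → Rd d) where
  toFun := sample m
  map_add' _ _ := rfl
  map_smul' _ _ := rfl
  cont := continuous_pi fun _ => (continuous_eval_const _).comp continuous_subtype_val

/-- The reduction to finite dimension: dilation of the lift becomes scalar multiplication of the
sample vector. -/
theorem dilatedLift_eq (p : ℝ) (ε : ℝ) (w : PathSpace d) :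
    dilatedLift p m ε w = Phi p m (ε • sampleCLM d m w) := by
  rw [dilatedLift, dilate_dyadicLift]
  rfl

end Dyadic

/-! ### The Gaussian law of the sample vector -/

section Sample

variable {d : ℕ} {Ω : Type*} [MeasurableSpace Ω] {μ : Measure Ω} {B : ℝ≥0 → Ω → Rd d}
  {P : Measure (PathSpace d)}

/-- The time `(k + 1) / 2^m`, as an element of `[0,1]`. -/
noncomputable def dyadicTime (m : ℕ) (k : Fin (2 ^ m)) : I :=
  ⟨((k : ℕ) + 1) / 2 ^ m, by positivity, by
    rw [div_le_one (by positivity)]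
    exact_mod_cast k.2⟩

/-- The law of the sample vector is that of the sampled process. -/
theorem map_sampleCLM (hB : ∀ t, Measurable (B t)) (hP : IsPathLaw P B μ) (m : ℕ) :
    P.map (sampleCLM d m)
      = μ.map fun ω k => B (unitInterval.toNNReal (dyadicTime m k)) ω := by
  have h1 : Measurable fun (w : PathSpace d) (t : I) => (w : C(I, Rd d)) t :=
    measurable_pi_iff.2 fun t => ((continuous_eval_const t).comp
      continuous_subtype_val).measurable
  have h2 : Measurable fun (ω : Ω) (t : I) => B ⟨(t : ℝ), t.2.1⟩ ω :=
    measurable_pi_iff.2 fun t => hB _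
  have h3 : Measurable fun (f : I → Rd d) (k : Fin (2 ^ m)) => f (dyadicTime m k) :=
    measurable_pi_iff.2 fun k => measurable_pi_apply _
  have := congrArg (Measure.map fun (f : I → Rd d) (k : Fin (2 ^ m)) => f (dyadicTime m k)) hP
  rwa [Measure.map_map h3 h1, Measure.map_map h3 h2] at this

theorem isGaussian_map_sampleCLM (hB : ∀ t, Measurable (B t)) (hG : IsGaussianProcess B μ)
    (hP : IsPathLaw P B μ) (m : ℕ) : IsGaussian (P.map (sampleCLM d m)) := by
  classical
  rw [map_sampleCLM hB hP]
  let τ : Fin (2 ^ m) → ℝ≥0 := fun k => unitInterval.toNNReal (dyadicTime m k)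
  let S : Finset ℝ≥0 := Finset.univ.image τ
  -- Gaussian processes are defined through finite sets of times; this linear map reindexes them by
  -- k.
  let R : (S → Rd d) →L[ℝ] (Fin (2 ^ m) → Rd d) := ContinuousLinearMap.pi fun k =>
    ContinuousLinearMap.proj (R := ℝ) (φ := fun _ : S => Rd d)
      ⟨τ k, Finset.mem_image_of_mem τ (Finset.mem_univ k)⟩
  exact ((hG.hasGaussianLaw S).map R).isGaussian_map

theorem integral_map_sampleCLM (hB : ∀ t, Measurable (B t)) (hG : IsGaussianProcess B μ)
    (h0 : ∀ t, ∫ ω, B t ω ∂μ = 0) (hP : IsPathLaw P B μ) (m : ℕ)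
    (φ : StrongDual ℝ (Fin (2 ^ m) → Rd d)) : ∫ y, φ y ∂(P.map (sampleCLM d m)) = 0 := by
  rw [map_sampleCLM hB hP, integral_map (measurable_pi_iff.2 fun k => hB _).aemeasurable
    φ.continuous.aestronglyMeasurable]
  have hi : ∀ k : Fin (2 ^ m), Integrable
      (B (unitInterval.toNNReal (dyadicTime m k))) μ := fun k =>
    (hG.hasGaussianLaw_eval _).integrable
  rw [φ.integral_comp_comm (Integrable.of_eval hi)]
  have : ∫ ω, (fun k => B (unitInterval.toNNReal (dyadicTime m k)) ω) ∂μ = 0 := by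
    ext1 k
    rw [eval_integral hi]
    exact h0 _
  rw [this, map_zero]

/-- The capacity large deviation principle for the image, under a continuous map, of a small
multiple of the sample vector. -/
theorem capLDP_of_sample {m : ℕ} {q : ℝ} (hq : 1 < q) (N : ℕ) {X : Type*} [TopologicalSpace X]
    [T2Space X] (hG : IsGaussian (P.map (sampleCLM d m)))
    (hcent : ∀ φ : StrongDual ℝ (Fin (2 ^ m) → Rd d), ∫ y, φ y ∂(P.map (sampleCLM d m)) = 0)
    {Φ : (Fin (2 ^ m) → Rd d) → X} (hΦ : Continuous Φ) {T : ℝ → PathSpace d → X}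
    (hT : ∀ ε w, T ε w = Φ (ε • sampleCLM d m w)) :
    CapLDP P q N T fun y => ⨅ (x : Fin (2 ^ m) → Rd d) (_ : Φ x = y),
      gaussianRate (P.map (sampleCLM d m)) x :=
  capLDP_of_isGaussian_map hq N hcent hΦ hT

end Sample

end RoughCap

open RoughCap
theorem mainTheorem8 {d : ℕ} {h p : ℝ} (h_lower : 1 / 4 < h) (h_upper : h ≤ 1 / 2)
    (p_lower : 2 < p) (p_upper : p < 4) (hp : 1 < h * p)
    {Ω : Type*} [MeasurableSpace Ω] {μ : Measure Ω} {B : ℝ≥0 → Ω → Rd d}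
    (hB : HasLongTimeMemory h B μ) (P : Measure (PathSpace d)) (hP : IsPathLaw P B μ)
    (q : ℝ) (hq : 1 < q) (N : ℕ) (m : ℕ) (hm : 1 ≤ m) :
    CapLDP P q N (dilatedLift (d := d) p m) (liftRate P p m) := by
  exact capLDP_of_sample hq N (isGaussian_map_sampleCLM hB.measurable hB.gaussian hP m)
    (integral_map_sampleCLM hB.measurable hB.gaussian hB.centred hP m) (continuous_Phi (d := d) p m)
    (dilatedLift_eq (d := d) p)
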